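/- Let $n\ge 1$ and $c>0$. Let $\mathcal F(\mathbb R^n)$ be the set of lower semicontinuous convex functions $f:\mathbb R^n\to\mathbb R\cup\{+\infty\}$ that are finite in at least one point, and let $f^*(y)=\sup_{x\in\mathbb R^n}\{x\cdot y-f(x)\}$. A function $f$ on $\mathbb R^n$ is symmetric if $f(-x)=f(x)$ for all $x$, and unconditional if $f(\varepsilon_1x_1,\dots,\varepsilon_nx_n)=f(x)$ for all $x$ and all $\varepsilon\in\{-1,1\}^n$; a Borel measure on $\mathbb R^n$ is symmetric (unconditional) if it is invariant under $x\mapsto -x$ (under all maps $x\mapsto(\varepsilon_1x_1,\dots,\varepsilon_nx_n)$, $\varepsilon\in\{-1,1\}^n$). One says that $\mathrm{IS}_n(c)$ holds if $$\int_{\mathbb R^n} e^{-f}\,dx\int_{\mathbb R^n} e^{-f^*}\,dx\ \ge\ c^n$$ for every $f\in\mathcal F(\mathbb R^n)$ with $\int e^{-f}\,dx>0$ and $\int e^{-f^*}\,dx>0$, and that $\mathrm{IS}_{n,s}(c)$ (respectively $\mathrm{IS}_{n,u}(c)$) holds if this is true for every such $f$ that is symmetric (respectively unconditional). Let $\mathcal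 P_1(\mathbb R^n)$ be the set of Borel probability measures on $\mathbb R^n$ with finite first moment. For $\nu,\nu_1,\nu_2\in\mathcal P_1(\mathbb R^n)$ put $$K(\nu|\mathrm{Leb})=\sup_{f\in L^1(\nu)\cap\mathcal F(\mathbb R^n)}\Big\{\int(-f)\,d\nu+\log\int e^{-f^*}\,dx\Big\},\qquad \mathcal T(\nu_1,\nu_2)=\inf_{f\in\mathcal F(\mathbb R^n)}\Big\{\int f\,d\nu_1+\int f^*\,d\nu_2\Big\}.$$ These quantities take values in $\mathbb R\cup\{+\infty\}$. Consider the inequality $$K(\nu_1|\mathrm{Leb})+K(\nu_2|\mathrm{Leb})\ \ge\ n\log c-\mathcal T(\nu_1,\nu_2).\qquad(\ast)$$ The following three statements are equivalent: (i) $\mathrm{IS}_n(c)$ holds; (ii) $(\ast)$ holds for all $\nu_1,\nu_2\in\mathcal P_1(\mathbb R^n)$; (iii) $(\ast)$ holds for all compactly supported Borel probability measures $\nu_1,\nu_2$ on $\mathbb R^n$. The same equivalence holds with $\mathrm{IS}_{n,u}(c)$ in (i) and with $\nu_1,\nu_2$ in (ii) and (iii) required in addition to be unconditional, and with $\mathrm{IS}_{n,s}(c)$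 in (i) and $\nu_1,\nu_2$ in (ii) and (iii) required in addition to be symmetric. -/

import Mathlib

open MeasureTheory

noncomputable section

namespace InverseSantalo

/-- Euclidean space of dimension `n`, with its Borel sets and Lebesgue measure `volume`. -/
abbrev E (n : ℕ) : Type := EuclideanSpace ℝ (Fin n)

/-- The lower semicontinuous convex functions with values in the reals or `+∞`
that are finite in at least one point. -/
def F (n : ℕ) : Set (E n → EReal) :=
  {f | LowerSemicontinuous f ∧
    (∀ x y : E n, ∀ a b : ℝ, 0 < a → 0 < b → a + b = 1 →
      f (a • x + b • y) ≤ (a : EReal) * f x + (b : EReal) * f y) ∧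
    (∀ x, f x ≠ ⊥) ∧ (∃ x, f x ≠ ⊤)}

/-- The change of signs of the coordinates by `ε`. -/
def signFlip {n : ℕ} (ε : Fin n → ℝ) (x : E n) : E n :=
  WithLp.toLp 2 (fun i => ε i * x i)

/-- All the coordinates of `ε` are `1` or `-1`. -/
def IsSign {n : ℕ} (ε : Fin n → ℝ) : Prop := ∀ i, ε i = 1 ∨ ε i = -1

/-- The symmetric (even) elements of `F n`. -/
def Fs (n : ℕ) : Set (E n → EReal) :=
  {f | f ∈ F n ∧ ∀ x, f (-x) = f x}

/-- The unconditional elements of `F n`. -/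
def Fu (n : ℕ) : Set (E n → EReal) :=
  {f | f ∈ F n ∧ ∀ ε : Fin n → ℝ, IsSign ε → ∀ x, f (signFlip ε x) = f x}

/-- The Fenchel-Legendre transform. -/
def conj {n : ℕ} (f : E n → EReal) (y : E n) : EReal :=
  ⨆ x : E n, ((inner ℝ x y : ℝ) : EReal) - f x

/-- The integral of the exponential of `-f` with respect to `m`. -/
def expInt {n : ℕ} (m : Measure (E n)) (f : E n → EReal) : ENNReal :=
  ∫⁻ x, EReal.exp (-(f x)) ∂m

/-- The inequality `∫ e^{-f} ∫ e^{-f*} ≥ c^n` for all `f` in the class `A`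
for which both integrals are positive. -/
def SantaloOn {n : ℕ} (A : Set (E n → EReal)) (c : ℝ) : Prop :=
  ∀ f ∈ A, 0 < expInt volume f → 0 < expInt volume (conj f) →
    ENNReal.ofReal c ^ n ≤ expInt volume f * expInt volume (conj f)

/-- The functional inverse Santaló inequality. -/
def IS (n : ℕ) (c : ℝ) : Prop := SantaloOn (F n) c

/-- The symmetric functional inverse Santaló inequality. -/
def ISs (n : ℕ) (c : ℝ) : Prop := SantaloOn (Fs n) c

/-- The unconditional functional inverse Santaló inequality. -/
def ISu (n : ℕ) (c : ℝ) : Prop := SantaloOn (Fu n) c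

/-- Borel probability measures with a finite first moment. -/
def P1 (n : ℕ) : Set (Measure (E n)) :=
  {ν | IsProbabilityMeasure ν ∧ Integrable (fun x => ‖x‖) ν}

/-- Compactly supported Borel probability measures. -/
def Pc (n : ℕ) : Set (Measure (E n)) :=
  {ν | IsProbabilityMeasure ν ∧ ∃ C : Set (E n), IsCompact C ∧ ν Cᶜ = 0}

/-- Symmetric measures. -/
def SymmMeas (n : ℕ) : Set (Measure (E n)) :=
  {ν | ν.map (fun x => -x) = ν}

/-- Unconditional measures. -/
def UncondMeas (n : ℕ) : Set (Measure (E n)) :=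
  {ν | ∀ ε : Fin n → ℝ, IsSign ε → ν.map (signFlip ε) = ν}

/-- The integral of the positive part of `f`. -/
def posInt {n : ℕ} (ν : Measure (E n)) (f : E n → EReal) : ENNReal :=
  ∫⁻ x, (f x).toENNReal ∂ν

/-- The integral of the negative part of `f`. -/
def negInt {n : ℕ} (ν : Measure (E n)) (f : E n → EReal) : ENNReal :=
  ∫⁻ x, (-(f x)).toENNReal ∂ν

/-- The integral of an extended real function, as the difference of the integrals of its positive
and negative parts. For `f ∈ F n` and `ν ∈ P1 n` the second one is finite, because `f` is bounded
below by an affine function, so that the value is a real number or `+∞`. -/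
def eInt {n : ℕ} (ν : Measure (E n)) (f : E n → EReal) : EReal :=
  (posInt ν f : EReal) - (negInt ν f : EReal)

/-- The elements of `F n` that are integrable with respect to `ν`. -/
def FL1 {n : ℕ} (ν : Measure (E n)) : Set (E n → EReal) :=
  {f | f ∈ F n ∧ posInt ν f < ⊤ ∧ negInt ν f < ⊤}

/-- The twisted log-Laplace functional `L(f|m) = -log ∫ e^{-f*} dm`. -/
def L {n : ℕ} (f : E n → EReal) (m : Measure (E n)) : EReal :=
  -ENNReal.log (expInt m (conj f))

/-- The twisted entropy `K(ν|m)`: the supremum of `∫ (-f) dν - L(f|m)` over the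
functions `f` in `F n` that are integrable with respect to `ν`. -/
def K {n : ℕ} (ν m : Measure (E n)) : EReal :=
  ⨆ f ∈ FL1 ν, eInt ν (fun x => -(f x)) - L f m

/-- The maximal correlation cost: the infimum over `F n` of `∫ f dν₁ + ∫ f* dν₂`. -/
def T {n : ℕ} (ν₁ ν₂ : Measure (E n)) : EReal :=
  ⨅ f ∈ F n, eInt ν₁ f + eInt ν₂ (conj f)

/-- The transport-entropy inequality `K(ν₁|Leb) + K(ν₂|Leb) ≥ n log c - T(ν₁, ν₂)` for all
`ν₁, ν₂` in the class `Q`. -/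
def TransportEntropyOn {n : ℕ} (Q : Set (Measure (E n))) (c : ℝ) : Prop :=
  ∀ ν₁ ∈ Q, ∀ ν₂ ∈ Q,
    K ν₁ volume + K ν₂ volume ≥ (((n : ℝ) * Real.log c : ℝ) : EReal) - T ν₁ ν₂

end InverseSantalo

end

namespace InverseSantalo

/-! From (i) to (ii), take `f` with `f` and `f*` integrable against `ν₁` and `ν₂`, and test the two
suprema defining `K` with `f` and `f*`. Since `f** = f`, adding the two bounds and inserting the
inverse Santaló inequality gives (∗). If `∫ e^{-f}` or `∫ e^{-f*}` vanishes, that inequality is not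
available, but then one of the entropies is `+∞` (`K_eq_top`). In the symmetric and unconditional
cases `f` is first averaged over the group, which increases neither integral
(`exists_invariant_le`).

From (iii) to (i), what is needed is a near-optimal measure: for each `f` with `0 < ∫ e^{-f*} < ∞`,
a compactly supported `ν` with `K(ν) ≤ log ∫ e^{-f*} - ∫ f dν + ε` (`exists_measure_K_le`). Applied
to `f` and to `f*`, with `T` bounded by its value at `f`, it turns (∗) into the inverse Santaló
inequality up to an error `ε`.

The measure is a moment measure. Restrict `f` to a large ball and let `V` be the conjugate of the
restriction, a finite Lipschitz convex function; `ν` is the image under `∇V` of the probability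
density proportional to `e^{-V}`. For every admissible `g`, Prékopa-Leindler applied to `e^{-V}` and
`e^{-g*}` with weights `1 - t` and `t`, differentiated at `t = 0`, gives `log ∫ e^{-g*} - ∫ g dν ≤
log ∫ e^{-V} - ∫ f dν` (`K_map_gradient_le`). As the ball grows, `∫ e^{-V}` decreases to `∫
e^{-f*}`. The construction commutes with the isometries preserving `f`, so `ν` inherits its
symmetries. -/

/-! ### Brunn-Minkowski on the line and Prékopa-Leindler in all dimensions -/

/-- The translates `K + min L` and `max K + L` both lie in `C` and meet only at the point `max K +
min L`. -/
theorem volume_add_le_of_isCompact {K L C : Set ℝ} (hK : IsCompact K) (hL : IsCompact L)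
    (hKn : K.Nonempty) (hLn : L.Nonempty) (hC : ∀ a ∈ K, ∀ b ∈ L, a + b ∈ C) :
    volume K + volume L ≤ volume C := by
  have ha := hK.sSup_mem hKn
  have hb := hL.sInf_mem hLn
  set a := sSup K
  set b := sInf L
  have hKi : volume ((fun x => x + b) '' K) = volume K := by
    rw [Set.image_add_right, measure_preimage_add_right]
  have hLi : volume ((fun x => a + x) '' L) = volume L := by
    rw [Set.image_add_left, measure_preimage_add]
  have hLm : MeasurableSet ((fun x => a + x) '' L) :=
    (hL.image (by fun_prop)).measurableSet
  have hinter : volume (((fun x => x + b) '' K) ∩ ((fun x => a + x) '' L)) = 0 := by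
    refine measure_mono_null (t := {a + b}) ?_ (by simp)
    rintro _ ⟨⟨x, hx, rfl⟩, ⟨y, hy, hxy⟩⟩
    have h1 : x ≤ a := le_csSup hK.bddAbove hx
    have h2 : b ≤ y := csInf_le hL.bddBelow hy
    simp only [Set.mem_singleton_iff] at hxy ⊢
    linarith
  rw [← hKi, ← hLi, ← measure_union_add_inter _ hLm, hinter, add_zero]
  refine measure_mono ?_
  rintro _ (⟨x, hx, rfl⟩ | ⟨y, hy, rfl⟩)
  · exact hC _ hx _ hb
  · exact hC _ ha _ hy

theorem volume_add_le_of_forall_isCompact {A : Set ℝ} (hA : MeasurableSet A) (hAn : A.Nonempty)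
    {D M : ENNReal}
    (h : ∀ K ⊆ A, IsCompact K → K.Nonempty → volume K + D ≤ M) : volume A + D ≤ M := by
  obtain ⟨a, ha⟩ := hAn
  have hle : volume A ≤ ⨆ K : {K : Set ℝ // K ⊆ A ∧ IsCompact K ∧ K.Nonempty}, volume K.1 := by
    refine le_of_forall_lt fun r hr => ?_
    obtain ⟨K, hKA, hK, hrK⟩ := hA.exists_lt_isCompact hr
    refine hrK.trans_le ((measure_mono (Set.subset_insert a K)).trans ?_)
    -- A compact subset given by inner regularity may be empty; adjoining `a` repairs this without
    -- decreasing its measure.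
    exact le_iSup (fun K : {K : Set ℝ // K ⊆ A ∧ IsCompact K ∧ K.Nonempty} => volume K.1)
      ⟨insert a K, Set.insert_subset ha hKA, hK.insert a, Set.insert_nonempty a K⟩
  have : Nonempty {K : Set ℝ // K ⊆ A ∧ IsCompact K ∧ K.Nonempty} :=
    ⟨⟨{a}, by simpa using ha, isCompact_singleton, Set.singleton_nonempty a⟩⟩
  refine (add_le_add_left hle D).trans ?_
  rw [ENNReal.iSup_add]
  exact iSup_le fun K => h K.1 K.2.1 K.2.2.1 K.2.2.2

/-- The Brunn-Minkowski inequality on the real line. -/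
theorem volume_add_le_of_add_mem {A B C : Set ℝ} (hA : MeasurableSet A) (hB : MeasurableSet B)
    (hAn : A.Nonempty) (hBn : B.Nonempty) (hC : ∀ a ∈ A, ∀ b ∈ B, a + b ∈ C) :
    volume A + volume B ≤ volume C := by
  refine volume_add_le_of_forall_isCompact hA hAn fun K hKA hK hKn => ?_
  rw [add_comm]
  refine volume_add_le_of_forall_isCompact hB hBn fun L hLB hL hLn => ?_
  rw [add_comm]
  exact volume_add_le_of_isCompact hK hL hKn hLn fun a ha b hb => hC a (hKA ha) b (hLB hb)

theorem lintegral_eq_lintegral_measure_lt {f : ℝ → ENNReal} (hf : Measurable f)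
    (hfin : ∀ x, f x ≠ ⊤) :
    ∫⁻ x, f x = ∫⁻ s in Set.Ioi (0 : ℝ), volume {x | ENNReal.ofReal s < f x} := by
  have h := lintegral_eq_lintegral_meas_lt (volume : Measure ℝ) (f := fun x => (f x).toReal)
    (Filter.Eventually.of_forall fun x => ENNReal.toReal_nonneg) hf.ennreal_toReal.aemeasurable
  simp only [ENNReal.ofReal_toReal (hfin _)] at h
  rw [h]
  refine setLIntegral_congr_fun measurableSet_Ioi fun s hs => ?_
  congr 1
  ext x
  exact (ENNReal.ofReal_lt_iff_lt_toReal (le_of_lt hs) (hfin x)).symm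

/-- Layer-cake argument. With both suprema equal to `1`, the level sets of `f` and `g` at height `s
< 1` are nonempty, so one-dimensional Brunn-Minkowski applies to them at every relevant height. -/
theorem lintegral_add_le_of_min_le {t : ℝ} (ht0 : 0 < t) (ht1 : t < 1) {f g h : ℝ → ENNReal}
    (hf : Measurable f) (hg : Measurable g) (hh : Measurable h)
    (hfs : ⨆ x, f x = 1) (hgs : ⨆ x, g x = 1)
    (H : ∀ x y, min (f x) (g y) ≤ h ((1 - t) * x + t * y)) :
    ENNReal.ofReal (1 - t) * (∫⁻ x, f x) + ENNReal.ofReal t * (∫⁻ x, g x) ≤ ∫⁻ x, h x := by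
  have hf1 : ∀ x, f x ≤ 1 := fun x => hfs ▸ le_iSup f x
  have hg1 : ∀ x, g x ≤ 1 := fun x => hgs ▸ le_iSup g x
  -- Only heights below `1` matter, and capping `h` makes it finite, as the layer-cake formula
  -- requires.
  have hle : ∫⁻ x, min (h x) 1 ≤ ∫⁻ x, h x := lintegral_mono fun x => min_le_left _ _
  refine le_trans ?_ hle
  rw [lintegral_eq_lintegral_measure_lt hf fun x => ((hf1 x).trans_lt ENNReal.one_lt_top).ne,
    lintegral_eq_lintegral_measure_lt hg fun x => ((hg1 x).trans_lt ENNReal.one_lt_top).ne,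
    lintegral_eq_lintegral_measure_lt (hh.min measurable_const)
      fun x => ((min_le_right _ _).trans_lt ENNReal.one_lt_top).ne,
    ← lintegral_const_mul' _ _ ENNReal.ofReal_ne_top,
    ← lintegral_const_mul' _ _ ENNReal.ofReal_ne_top]
  refine (le_lintegral_add _ _).trans (lintegral_mono fun s => ?_)
  rcases le_or_gt 1 (ENNReal.ofReal s) with hs | hs
  · have e1 : {x | ENNReal.ofReal s < f x} = ∅ :=
      Set.eq_empty_of_forall_notMem fun x hx => absurd (lt_of_lt_of_le hx ((hf1 x).trans hs))
        (lt_irrefl _)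
    have e2 : {x | ENNReal.ofReal s < g x} = ∅ :=
      Set.eq_empty_of_forall_notMem fun x hx => absurd (lt_of_lt_of_le hx ((hg1 x).trans hs))
        (lt_irrefl _)
    simp [e1, e2]
  · have ht1' : 0 < 1 - t := by linarith
    have key := volume_add_le_of_add_mem (A := (fun x => (1 - t)⁻¹ * x) ⁻¹' {x | ENNReal.ofReal s < f x})
      (B := (fun x => t⁻¹ * x) ⁻¹' {x | ENNReal.ofReal s < g x})
      (C := {x | ENNReal.ofReal s < min (h x) 1})
      ((measurableSet_lt measurable_const hf).preimage (by fun_prop))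
      ((measurableSet_lt measurable_const hg).preimage (by fun_prop)) ?_ ?_ ?_
    · rw [Real.volume_preimage_mul_left (inv_ne_zero ht1'.ne'),
        Real.volume_preimage_mul_left (inv_ne_zero ht0.ne'), inv_inv, inv_inv,
        abs_of_pos ht1', abs_of_pos ht0] at key
      exact key
    · obtain ⟨x, hx⟩ := lt_iSup_iff.1 (hs.trans_eq hfs.symm)
      exact ⟨(1 - t) * x, by simpa [ht1'.ne'] using hx⟩
    · obtain ⟨x, hx⟩ := lt_iSup_iff.1 (hs.trans_eq hgs.symm)
      exact ⟨t * x, by simpa [ht0.ne'] using hx⟩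
    · intro a ha b hb
      have := H ((1 - t)⁻¹ * a) (t⁻¹ * b)
      rw [mul_inv_cancel_left₀ ht1'.ne', mul_inv_cancel_left₀ ht0.ne'] at this
      exact lt_min ((lt_min ha hb).trans_le this) hs

theorem rpow_mul_rpow_le {t : ℝ} (ht0 : 0 < t) (ht1 : t < 1) (x y : ENNReal) :
    x ^ (1 - t) * y ^ t ≤ ENNReal.ofReal (1 - t) * x + ENNReal.ofReal t * y := by
  have ht1' : 0 < 1 - t := by linarith
  rcases eq_or_ne x ⊤ with rfl | hx
  · rw [ENNReal.mul_top (by simpa using ht1), top_add]; exact le_top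
  rcases eq_or_ne y ⊤ with rfl | hy
  · rw [ENNReal.mul_top (by simpa using ht0), add_top]; exact le_top
  lift x to NNReal using hx
  lift y to NNReal using hy
  rw [← ENNReal.coe_rpow_of_nonneg _ ht1'.le, ← ENNReal.coe_rpow_of_nonneg _ ht0.le,
    ENNReal.ofReal, ENNReal.ofReal]
  have := NNReal.geom_mean_le_arith_mean2_weighted (Real.toNNReal (1 - t)) (Real.toNNReal t) x y
    (by rw [← Real.toNNReal_add ht1'.le ht0.le]; simp)
  rw [Real.coe_toNNReal _ ht1'.le, Real.coe_toNNReal _ ht0.le] at this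
  exact_mod_cast this

theorem min_le_rpow_mul_rpow {t : ℝ} (ht0 : 0 < t) (ht1 : t < 1) (x y : ENNReal) :
    min x y ≤ x ^ (1 - t) * y ^ t := by
  have ht1' : 0 < 1 - t := by linarith
  calc min x y = (min x y) ^ ((1 - t) + t) := by simp
    _ = (min x y) ^ (1 - t) * (min x y) ^ t := ENNReal.rpow_add_of_nonneg _ _ ht1'.le ht0.le
    _ ≤ _ := mul_le_mul' (ENNReal.rpow_le_rpow (min_le_left _ _) ht1'.le)
        (ENNReal.rpow_le_rpow (min_le_right _ _) ht0.le)

/-- Dividing `f`, `g`, `h` by `a`, `b` and `a^(1-t) b^t` reduces to suprema equal to `1`; the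
arithmetic-geometric mean inequality then turns the additive bound into the multiplicative one. -/
theorem prekopa_leindler_real_of_le {t : ℝ} (ht0 : 0 < t) (ht1 : t < 1) {f g h : ℝ → ENNReal}
    (hf : Measurable f) (hg : Measurable g) (hh : Measurable h) {N : ENNReal} (hN : N ≠ ⊤)
    (hfN : ∀ x, f x ≤ N) (hgN : ∀ x, g x ≤ N)
    (H : ∀ x y, f x ^ (1 - t) * g y ^ t ≤ h ((1 - t) * x + t * y)) :
    (∫⁻ x, f x) ^ (1 - t) * (∫⁻ x, g x) ^ t ≤ ∫⁻ x, h x := by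
  have ht1' : 0 < 1 - t := by linarith
  set a := ⨆ x, f x with ha
  set b := ⨆ x, g x with hb
  have ha' : a ≠ ⊤ := ((iSup_le hfN).trans_lt hN.lt_top).ne
  have hb' : b ≠ ⊤ := ((iSup_le hgN).trans_lt hN.lt_top).ne
  rcases eq_or_ne a 0 with h0 | ha0
  · have : ∀ x, f x = 0 := fun x => le_antisymm (h0 ▸ le_iSup f x) zero_le
    simp [this, ht1']
  rcases eq_or_ne b 0 with h0 | hb0
  · have : ∀ x, g x = 0 := fun x => le_antisymm (h0 ▸ le_iSup g x) zero_le
    simp [this, ht0]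
  set d := a ^ (1 - t) * b ^ t with hd
  have hd0 : d ≠ 0 := mul_ne_zero (by simp [ENNReal.rpow_eq_zero_iff, ha0, ha'])
    (by simp [ENNReal.rpow_eq_zero_iff, hb0, hb'])
  have hd' : d ≠ ⊤ := ENNReal.mul_ne_top (ENNReal.rpow_ne_top_of_nonneg ht1'.le ha')
    (ENNReal.rpow_ne_top_of_nonneg ht0.le hb')
  have key := lintegral_add_le_of_min_le ht0 ht1 (f := fun x => a⁻¹ * f x)
    (g := fun x => b⁻¹ * g x) (h := fun x => d⁻¹ * h x) (hf.const_mul _) (hg.const_mul _)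
    (hh.const_mul _) (by rw [← ENNReal.mul_iSup, ← ha, ENNReal.inv_mul_cancel ha0 ha'])
    (by rw [← ENNReal.mul_iSup, ← hb, ENNReal.inv_mul_cancel hb0 hb']) ?_
  · have key' := (rpow_mul_rpow_le ht0 ht1 _ _).trans key
    rw [lintegral_const_mul _ hf, lintegral_const_mul _ hg, lintegral_const_mul _ hh,
      ENNReal.mul_rpow_of_nonneg _ _ ht1'.le, ENNReal.mul_rpow_of_nonneg _ _ ht0.le,
      ENNReal.inv_rpow, ENNReal.inv_rpow, mul_mul_mul_comm,
      ← ENNReal.mul_inv (Or.inr (ENNReal.rpow_ne_top_of_nonneg ht0.le hb'))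
        (Or.inl (ENNReal.rpow_ne_top_of_nonneg ht1'.le ha'))] at key'
    rwa [← hd, ENNReal.mul_le_mul_iff_right (ENNReal.inv_ne_zero.2 hd')
      (ENNReal.inv_ne_top.2 hd0)] at key'
  · intro x y
    refine (min_le_rpow_mul_rpow ht0 ht1 _ _).trans ?_
    rw [ENNReal.mul_rpow_of_nonneg _ _ ht1'.le, ENNReal.mul_rpow_of_nonneg _ _ ht0.le,
      ENNReal.inv_rpow, ENNReal.inv_rpow, mul_mul_mul_comm,
      ← ENNReal.mul_inv (Or.inr (ENNReal.rpow_ne_top_of_nonneg ht0.le hb'))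
        (Or.inl (ENNReal.rpow_ne_top_of_nonneg ht1'.le ha'))]
    exact mul_le_mul' le_rfl (H x y)

theorem tendsto_lintegral_min_natCast {f : ℝ → ENNReal} (hf : Measurable f) :
    Filter.Tendsto (fun N : ℕ => ∫⁻ x, min (f x) N) Filter.atTop (nhds (∫⁻ x, f x)) := by
  refine lintegral_tendsto_of_tendsto_of_monotone
    (fun N => (hf.min measurable_const).aemeasurable)
    (Filter.Eventually.of_forall fun x N M hNM => min_le_min_left _ (by exact_mod_cast hNM))
    (Filter.Eventually.of_forall fun x => ?_)
  have := (tendsto_const_nhds (x := f x)).min ENNReal.tendsto_nat_nhds_top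
  simpa using this

theorem prekopa_leindler_real {t : ℝ} (ht0 : 0 < t) (ht1 : t < 1) {f g h : ℝ → ENNReal}
    (hf : Measurable f) (hg : Measurable g) (hh : Measurable h)
    (H : ∀ x y, f x ^ (1 - t) * g y ^ t ≤ h ((1 - t) * x + t * y)) :
    (∫⁻ x, f x) ^ (1 - t) * (∫⁻ x, g x) ^ t ≤ ∫⁻ x, h x := by
  have ht1' : 0 < 1 - t := by linarith
  rcases eq_or_ne (∫⁻ x, f x) 0 with h0 | hf0
  · simp [h0, ht1']
  rcases eq_or_ne (∫⁻ x, g x) 0 with h0 | hg0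
  · simp [h0, ht0]
  have hlim : Filter.Tendsto
      (fun N : ℕ => (∫⁻ x, min (f x) N) ^ (1 - t) * (∫⁻ x, min (g x) N) ^ t) Filter.atTop
      (nhds ((∫⁻ x, f x) ^ (1 - t) * (∫⁻ x, g x) ^ t)) := by
    refine ENNReal.Tendsto.mul
      ((ENNReal.continuous_rpow_const.tendsto _).comp (tendsto_lintegral_min_natCast hf)) (Or.inl ?_)
      ((ENNReal.continuous_rpow_const.tendsto _).comp (tendsto_lintegral_min_natCast hg)) (Or.inl ?_)
    · simp [ENNReal.rpow_eq_zero_iff, hf0, ht1.le]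
    · simp [ENNReal.rpow_eq_zero_iff, hg0, ht0.le]
  refine le_of_tendsto' hlim fun N => ?_
  refine prekopa_leindler_real_of_le ht0 ht1 (hf.min measurable_const) (hg.min measurable_const) hh
    (ENNReal.natCast_ne_top N) (fun x => min_le_right _ _) (fun x => min_le_right _ _) fun x y => ?_
  exact (mul_le_mul' (ENNReal.rpow_le_rpow (min_le_left _ _) ht1'.le)
    (ENNReal.rpow_le_rpow (min_le_left _ _) ht0.le)).trans (H x y)

theorem lintegral_fin_succ {n : ℕ} {f : (Fin (n + 1) → ℝ) → ENNReal} (hf : Measurable f) :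
    ∫⁻ x, f x = ∫⁻ x : ℝ, ∫⁻ y : Fin n → ℝ, f (Fin.cons x y) := by
  have e := (volume_preserving_piFinSuccAbove (fun _ : Fin (n + 1) => ℝ) 0).symm
  rw [← e.lintegral_comp hf, Measure.volume_eq_prod,
    lintegral_prod (fun p => f ((MeasurableEquiv.piFinSuccAbove (fun _ => ℝ) 0).symm p))
      (hf.comp (MeasurableEquiv.measurable _)).aemeasurable]
  simp [MeasurableEquiv.piFinSuccAbove, Fin.insertNthEquiv]

/-- Induction by Fubini: the inequality on slices is exactly the hypothesis of the one-dimensional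
inequality for the marginals. -/
theorem prekopa_leindler_pi {t : ℝ} (ht0 : 0 < t) (ht1 : t < 1) (n : ℕ)
    {f g h : (Fin n → ℝ) → ENNReal}
    (hf : Measurable f) (hg : Measurable g) (hh : Measurable h)
    (H : ∀ x y, f x ^ (1 - t) * g y ^ t ≤ h ((1 - t) • x + t • y)) :
    (∫⁻ x, f x) ^ (1 - t) * (∫⁻ x, g x) ^ t ≤ ∫⁻ x, h x := by
  induction n with
  | zero =>
    have hx : ∀ k : (Fin 0 → ℝ) → ENNReal, ∫⁻ x, k x = k 0 := fun k => by
      rw [lintegral_unique, volume_pi, Measure.pi_univ]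
      simp only [Finset.univ_eq_empty, Finset.prod_empty, mul_one]
      exact congrArg k (Subsingleton.elim _ _)
    rw [hx, hx, hx]
    simpa using H 0 0
  | succ n ih =>
    have hc : Measurable fun p : ℝ × (Fin n → ℝ) => (Fin.cons p.1 p.2 : Fin (n + 1) → ℝ) := by
      refine measurable_pi_lambda _ fun i => ?_
      refine Fin.cases ?_ (fun j => ?_) i
      · simpa using measurable_fst
      · simp only [Fin.cons_succ]; fun_prop
    rw [lintegral_fin_succ hf, lintegral_fin_succ hg, lintegral_fin_succ hh]
    refine prekopa_leindler_real ht0 ht1 (hf.comp hc).lintegral_prod_right'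
      (hg.comp hc).lintegral_prod_right' (hh.comp hc).lintegral_prod_right' fun x y => ?_
    refine ih (hf.comp (hc.comp measurable_prodMk_left)) (hg.comp (hc.comp measurable_prodMk_left))
      (hh.comp (hc.comp measurable_prodMk_left)) fun u v => ?_
    refine (H _ _).trans_eq (congrArg h ?_)
    ext i
    refine Fin.cases ?_ (fun j => ?_) i <;> simp

/-- The Prékopa-Leindler inequality. -/
theorem prekopa_leindler {t : ℝ} (ht0 : 0 < t) (ht1 : t < 1) {n : ℕ} {f g h : E n → ENNReal}
    (hf : Measurable f) (hg : Measurable g) (hh : Measurable h)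
    (H : ∀ x y, f x ^ (1 - t) * g y ^ t ≤ h ((1 - t) • x + t • y)) :
    (∫⁻ x, f x) ^ (1 - t) * (∫⁻ x, g x) ^ t ≤ ∫⁻ x, h x := by
  have e := PiLp.volume_preserving_toLp (Fin n)
  rw [← e.lintegral_comp hf, ← e.lintegral_comp hg, ← e.lintegral_comp hh]
  exact prekopa_leindler_pi ht0 ht1 n (hf.comp e.measurable) (hg.comp e.measurable)
    (hh.comp e.measurable) fun x y => (H _ _).trans_eq (by simp)

/-! ### The Legendre transform and the Fenchel-Moreau theorem -/

variable {n : ℕ}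

theorem le_conj (f : E n → EReal) (x y : E n) : ((inner ℝ x y : ℝ) : EReal) - f x ≤ conj f y :=
  le_iSup (fun x => ((inner ℝ x y : ℝ) : EReal) - f x) x

theorem conj_anti {f g : E n → EReal} (h : ∀ x, f x ≤ g x) (y : E n) : conj g y ≤ conj f y :=
  iSup_mono fun x => EReal.sub_le_sub le_rfl (h x)

theorem lowerSemicontinuous_conj (f : E n → EReal) : LowerSemicontinuous (conj f) := by
  refine lowerSemicontinuous_iSup fun x => ?_
  induction h : f x with
  | bot => simpa using lowerSemicontinuous_const
  | top => simpa using lowerSemicontinuous_const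
  | coe r =>
    refine Continuous.lowerSemicontinuous ?_
    have : ∀ y : E n, ((inner ℝ x y : ℝ) : EReal) - r = ((inner ℝ x y - r : ℝ) : EReal) := fun y => by
      norm_cast
    simp only [this]
    exact continuous_coe_real_ereal.comp (by fun_prop)

theorem measurable_conj (f : E n → EReal) : Measurable (conj f) :=
  (lowerSemicontinuous_conj f).measurable

theorem conj_convex {f : E n → EReal} (hbot : ∀ x, f x ≠ ⊥) (x y : E n) (a b : ℝ) (ha : 0 < a)
    (hb : 0 < b) (hab : a + b = 1) :
    conj f (a • x + b • y) ≤ (a : EReal) * conj f x + (b : EReal) * conj f y := by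
  refine iSup_le fun z => ?_
  have h1 := le_conj f z x
  have h2 := le_conj f z y
  induction h : f z with
  | bot => exact absurd h (hbot z)
  | top => simp
  | coe r =>
    rw [h] at h1 h2
    have e : ((inner ℝ z (a • x + b • y) : ℝ) : EReal) - r =
        (a : EReal) * (((inner ℝ z x : ℝ) : EReal) - r) +
          (b : EReal) * (((inner ℝ z y : ℝ) : EReal) - r) := by
      norm_cast
      rw [inner_add_right, real_inner_smul_right, real_inner_smul_right]
      linear_combination r * hab
    rw [e]
    exact add_le_add (mul_le_mul_of_nonneg_left h1 (by exact_mod_cast ha.le))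
      (mul_le_mul_of_nonneg_left h2 (by exact_mod_cast hb.le))

theorem conj_ne_bot {f : E n → EReal} (hf : ∃ x, f x ≠ ⊤) (y : E n) : conj f y ≠ ⊥ := by
  obtain ⟨x, hx⟩ := hf
  intro h
  have := le_conj f x y
  rw [h, le_bot_iff] at this
  induction hfx : f x with
  | bot => rw [hfx] at this; simp at this
  | top => exact hx hfx
  | coe r =>
    rw [hfx] at this
    exact EReal.coe_ne_bot (inner ℝ x y - r) (by exact_mod_cast this)

theorem conj_conj_le {f : E n → EReal} (hbot : ∀ x, f x ≠ ⊥) (x : E n) :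
    conj (conj f) x ≤ f x := by
  refine iSup_le fun y => ?_
  have h1 := le_conj f x y
  rw [real_inner_comm x y]
  induction h : f x with
  | bot => exact absurd h (hbot x)
  | top => simp
  | coe r =>
    rw [h] at h1
    induction h' : conj f y with
    | bot =>
      rw [h', le_bot_iff] at h1
      exact absurd (by exact_mod_cast h1) (EReal.coe_ne_bot (inner ℝ x y - r))
    | top => simp
    | coe s =>
      rw [h'] at h1
      norm_cast at h1 ⊢
      linarith

/-- Hahn-Banach separation of `(x₀, r)` from the closed convex epigraph. The vertical coefficient
`s` is nonnegative because the epigraph is unbounded upwards. -/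
theorem exists_separation {f : E n → EReal} (hf : f ∈ F n) {x₀ : E n} {r : ℝ}
    (hr : (r : EReal) < f x₀) :
    ∃ (w : E n) (s β : ℝ), 0 ≤ s ∧ inner ℝ w x₀ + s * r < β ∧
      ∀ (x : E n) (t : ℝ), f x ≤ t → β < inner ℝ w x + s * t := by
  obtain ⟨hlsc, hconv, hbot, x₁, hx₁⟩ := hf
  set S : Set (E n × ℝ) := {p | f p.1 ≤ p.2} with hS
  have hSc : IsClosed S := hlsc.isClosed_epigraph.preimage
    (f := fun p : E n × ℝ => (p.1, (p.2 : EReal)))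
    (continuous_fst.prodMk (continuous_coe_real_ereal.comp continuous_snd))
  have hSconv : Convex ℝ S := by
    rw [convex_iff_forall_pos]
    rintro ⟨x, s⟩ hx ⟨y, t⟩ hy a b ha hb hab
    refine (hconv x y a b ha hb hab).trans ?_
    refine (add_le_add (mul_le_mul_of_nonneg_left hx (by exact_mod_cast ha.le))
      (mul_le_mul_of_nonneg_left hy (by exact_mod_cast hb.le))).trans ?_
    norm_cast
  obtain ⟨ℓ, β, hl1, hl2⟩ := geometric_hahn_banach_point_closed hSconv hSc
    (x := (x₀, r)) (by simpa [hS] using hr)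
  set w := (InnerProductSpace.toDual ℝ (E n)).symm (ℓ.comp (ContinuousLinearMap.inl ℝ (E n) ℝ))
  have hw : ∀ x, inner ℝ w x = ℓ (x, 0) := fun x => by
    rw [InnerProductSpace.toDual_symm_apply]; simp
  have hl : ∀ x t, ℓ (x, t) = inner ℝ w x + ℓ (0, 1) * t := fun x t => by
    rw [hw, show (x, t) = (x, (0 : ℝ)) + t • ((0 : E n), (1 : ℝ)) by simp, map_add, map_smul,
      smul_eq_mul, mul_comm]
  have h2 : ∀ (x : E n) (t : ℝ), f x ≤ t → β < inner ℝ w x + ℓ (0, 1) * t := fun x t h => by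
    rw [← hl]; exact hl2 (x, t) h
  refine ⟨w, ℓ (0, 1), β, ?_, by rw [← hl]; exact hl1, h2⟩
  by_contra! hs
  obtain ⟨t₁, ht₁⟩ : ∃ t₁ : ℝ, f x₁ = t₁ := ⟨_, (EReal.coe_toReal hx₁ (hbot x₁)).symm⟩
  -- If `s < 0`, a point of the epigraph this high above `x₁` lies on the wrong side of the
  -- hyperplane.
  have h3 := h2 x₁ (max t₁ ((β - inner ℝ w x₁) / ℓ (0, 1))) (by
    rw [ht₁]; exact_mod_cast le_max_left _ _)
  have h4 := mul_le_mul_of_nonpos_left (le_max_right t₁ ((β - inner ℝ w x₁) / ℓ (0, 1))) hs.le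
  rw [mul_div_cancel₀ _ hs.ne] at h4
  linarith

theorem affine_le_of_separation {f : E n → EReal} (hbot : ∀ x, f x ≠ ⊥) {w : E n} {s β : ℝ}
    (hs : 0 < s) (h : ∀ (x : E n) (t : ℝ), f x ≤ t → β < inner ℝ w x + s * t) (x : E n) :
    ((s⁻¹ * (β - inner ℝ w x) : ℝ) : EReal) ≤ f x := by
  induction hx : f x with
  | bot => exact absurd hx (hbot x)
  | top => exact le_top
  | coe t =>
    have := h x t hx.le
    norm_cast
    rw [inv_mul_le_iff₀ hs]
    linarith

theorem exists_affine_le {f : E n → EReal} (hf : f ∈ F n) :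
    ∃ (u : E n) (α : ℝ), ∀ x, ((inner ℝ u x - α : ℝ) : EReal) ≤ f x := by
  obtain ⟨x₁, hx₁⟩ := hf.2.2.2
  obtain ⟨t₁, ht₁⟩ : ∃ t₁ : ℝ, f x₁ = t₁ := ⟨_, (EReal.coe_toReal hx₁ (hf.2.2.1 x₁)).symm⟩
  obtain ⟨w, s, β, hs, h1, h2⟩ := exists_separation hf (x₀ := x₁) (r := t₁ - 1) (by
    rw [ht₁]; exact_mod_cast sub_one_lt t₁)
  have h3 := h2 x₁ t₁ ht₁.le
  have hs' : 0 < s := by linarith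
  refine ⟨-(s⁻¹ • w), -(s⁻¹ * β), fun x => ?_⟩
  refine le_trans (le_of_eq ?_) (affine_le_of_separation hf.2.2.1 hs' h2 x)
  rw [inner_neg_left, real_inner_smul_left]
  norm_cast
  ring

theorem exists_affine_le_of_lt {f : E n → EReal} (hf : f ∈ F n) {x₀ : E n} {r : ℝ}
    (hr : (r : EReal) < f x₀) :
    ∃ (u : E n) (α : ℝ), (∀ x, ((inner ℝ u x - α : ℝ) : EReal) ≤ f x) ∧ r < inner ℝ u x₀ - α := by
  obtain ⟨w, s, β, hs, h1, h2⟩ := exists_separation hf hr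
  rcases hs.eq_or_lt with rfl | hs
  · obtain ⟨u, α, hu⟩ := exists_affine_le hf
    have hpos : 0 < β - inner ℝ w x₀ := by linarith
    -- Vertical hyperplane: adding to an affine minorant the multiple `c` of `β - ⟨w, x⟩`, negative
    -- on the domain of `f`, keeps it a minorant and lifts its value at `x₀` to at least `r + 1`.
    set c := max 0 ((r - (inner ℝ u x₀ - α) + 1) / (β - inner ℝ w x₀)) with hc
    have hc0 : 0 ≤ c := le_max_left _ _
    have hc1 : (r - (inner ℝ u x₀ - α) + 1) ≤ c * (β - inner ℝ w x₀) := by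
      rw [← div_le_iff₀ hpos]; exact le_max_right _ _
    refine ⟨u - c • w, α - c * β, fun x => ?_, ?_⟩
    · induction hx : f x with
      | bot => exact absurd hx (hf.2.2.1 x)
      | top => exact le_top
      | coe t =>
        have h3 := hu x
        rw [hx] at h3
        have h4 := h2 x t hx.le
        norm_cast at h3 ⊢
        rw [inner_sub_left, real_inner_smul_left]
        nlinarith
    · rw [inner_sub_left, real_inner_smul_left]
      linarith
  · refine ⟨-(s⁻¹ • w), -(s⁻¹ * β), fun x => ?_, ?_⟩
    · refine le_trans (le_of_eq ?_) (affine_le_of_separation hf.2.2.1 hs h2 x)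
      rw [inner_neg_left, real_inner_smul_left]
      norm_cast
      ring
    · rw [inner_neg_left, real_inner_smul_left]
      have : s * r < s * (s⁻¹ * (β - inner ℝ w x₀)) := by
        rw [mul_inv_cancel_left₀ hs.ne']; linarith
      have := lt_of_mul_lt_mul_left this hs.le
      linarith

theorem conj_le_of_affine_le {f : E n → EReal} {u : E n} {α : ℝ}
    (h : ∀ x, ((inner ℝ u x - α : ℝ) : EReal) ≤ f x) : conj f u ≤ α := by
  refine iSup_le fun x => ?_
  have hx := h x
  rw [real_inner_comm]
  refine (EReal.sub_le_sub le_rfl hx).trans (le_of_eq ?_)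
  norm_cast
  ring

/-- The Fenchel-Moreau theorem. -/
theorem conj_conj {f : E n → EReal} (hf : f ∈ F n) : conj (conj f) = f := by
  funext x
  refine le_antisymm (conj_conj_le hf.2.2.1 x) (EReal.ge_of_forall_gt_iff_ge.1 fun r hr => ?_)
  obtain ⟨u, α, h1, h2⟩ := exists_affine_le_of_lt hf hr
  have h3 : ((inner ℝ u x - α : ℝ) : EReal) ≤ conj (conj f) x := by
    refine le_trans ?_ (le_conj (conj f) u x)
    rw [EReal.coe_sub]
    exact EReal.sub_le_sub le_rfl (conj_le_of_affine_le h1)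
  exact le_trans (by exact_mod_cast h2.le) h3

theorem conj_mem_F {f : E n → EReal} (hf : f ∈ F n) : conj f ∈ F n := by
  refine ⟨lowerSemicontinuous_conj f, conj_convex hf.2.2.1, conj_ne_bot hf.2.2.2, ?_⟩
  obtain ⟨u, α, h⟩ := exists_affine_le hf
  exact ⟨u, ((conj_le_of_affine_le h).trans_lt (EReal.coe_lt_top α)).ne⟩

/-! ### Linear growth of a conjugate with finite exponential integral -/

/-- Cut the space into slabs orthogonal to `u` that translation by `u` shifts by one. Their
integrals are nondecreasing in the index, so a finite total would force them all to vanish. -/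
theorem lintegral_eq_top_of_le_translate {G : E n → ENNReal} {u : E n} (hu : u ≠ 0)
    (h : ∀ y, G y ≤ G (y + u)) (h0 : 0 < ∫⁻ y, G y) : ∫⁻ y, G y = ⊤ := by
  by_contra hfin
  set p : E n → ℤ := fun y => ⌊inner ℝ u y / ‖u‖ ^ 2⌋ with hp
  have hpm : Measurable p := Int.measurable_floor.comp (by fun_prop)
  have hpu : ∀ y, p (y + u) = p y + 1 := fun y => by
    have : ‖u‖ ^ 2 ≠ 0 := by simpa using hu
    simp only [hp]
    rw [inner_add_right, real_inner_self_eq_norm_sq, add_div, div_self this, Int.floor_add_one]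
  set a : ℤ → ENNReal := fun j => ∫⁻ y in p ⁻¹' {j}, G y with ha
  have hmeas : ∀ j, MeasurableSet (p ⁻¹' {j}) := fun j => hpm (measurableSet_singleton j)
  have hsum : ∑' j, a j = ∫⁻ y, G y := by
    rw [← lintegral_iUnion hmeas (fun i j hij => Set.disjoint_iff_inter_eq_empty.2 (by
      ext y; simp only [Set.mem_inter_iff, Set.mem_preimage, Set.mem_singleton_iff,
        Set.mem_empty_iff_false, iff_false]; rintro ⟨rfl, h⟩; exact hij h)),
      show (⋃ j, p ⁻¹' {j}) = Set.univ by ext y; simp, setLIntegral_univ]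
  have hstep : ∀ j, a j ≤ a (j + 1) := fun j => by
    have e : p ⁻¹' {j} = (fun y => y + u) ⁻¹' (p ⁻¹' {j + 1}) := by
      ext y; simp [hpu]
    calc a j ≤ ∫⁻ y in (fun y => y + u) ⁻¹' (p ⁻¹' {j + 1}), G (y + u) := by
          rw [← e]; exact lintegral_mono h
      _ = a (j + 1) :=
          (measurePreserving_add_right volume u).setLIntegral_comp_preimage_emb
            (measurableEmbedding_addRight u) G _
  have hmono : Monotone a := monotone_int_of_le_succ hstep
  obtain ⟨j, hj⟩ : ∃ j, a j ≠ 0 := by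
    by_contra! hz
    simp [hz] at hsum
    exact h0.ne hsum
  have htend := ENNReal.tendsto_cofinite_zero_of_tsum_ne_top (hsum ▸ hfin)
  have hev := htend.eventually (gt_mem_nhds (pos_iff_ne_zero.2 hj))
  rw [Filter.eventually_cofinite] at hev
  exact (Set.Ici_infinite j).mono (fun i hi => not_lt.2 (hmono hi)) hev

/-- If the domain of `f` lay in the half-space `⟨x, u⟩ ≤ 0`, then `f*` would not increase under
translation by `u`, and its exponential integral could not be positive and finite. -/
theorem exists_inner_pos {f : E n → EReal} (h0 : 0 < expInt volume (conj f))
    (h1 : expInt volume (conj f) ≠ ⊤) {u : E n} (hu : u ≠ 0) : ∃ x, f x ≠ ⊤ ∧ 0 < inner ℝ x u := by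
  by_contra! H
  refine h1 (lintegral_eq_top_of_le_translate hu (fun y => ?_) h0)
  rw [EReal.exp_le_exp_iff, EReal.neg_le_neg_iff]
  refine iSup_le fun x => ?_
  refine le_trans ?_ (le_conj f x y)
  rcases eq_or_ne (f x) ⊤ with hx | hx
  · simp [hx]
  · refine EReal.sub_le_sub ?_ le_rfl
    have := H x hx
    rw [inner_add_right]
    exact_mod_cast by linarith

theorem exists_finset_inner_ge {f : E n → EReal} (hf : ∃ x, f x ≠ ⊤)
    (h0 : 0 < expInt volume (conj f)) (h1 : expInt volume (conj f) ≠ ⊤) :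
    ∃ (s : Finset (E n)) (δ : ℝ), 0 < δ ∧ (∀ x ∈ s, f x ≠ ⊤) ∧
      ∀ u, ∃ x ∈ s, δ * ‖u‖ ≤ inner ℝ x u := by
  classical
  obtain ⟨x₁, hx₁⟩ := hf
  -- Compactness of the unit sphere makes the strict positivity uniform and uses only finitely many
  -- points of the domain.
  obtain ⟨I, hI⟩ := (isCompact_sphere (0 : E n) 1).elim_finite_subcover
    (fun q : {x : E n // f x ≠ ⊤} × ℕ => {u : E n | ((q.2 : ℝ) + 1)⁻¹ < inner ℝ q.1.1 u})
    (fun q => isOpen_lt continuous_const (by fun_prop)) (fun u hu => by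
      have hu0 : u ≠ 0 := by rintro rfl; simp at hu
      obtain ⟨x, hx, hxu⟩ := exists_inner_pos h0 h1 hu0
      obtain ⟨m, hm⟩ := exists_nat_gt (inner ℝ x u)⁻¹
      refine Set.mem_iUnion.2 ⟨(⟨x, hx⟩, m), ?_⟩
      exact inv_lt_of_inv_lt₀ hxu (hm.trans (lt_add_one _)))
  set M := I.sup Prod.snd with hM
  refine ⟨insert x₁ (I.image fun q => q.1.1), ((M : ℝ) + 1)⁻¹, by positivity, ?_, fun u => ?_⟩
  · intro x hx
    rcases Finset.mem_insert.1 hx with rfl | hx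
    · exact hx₁
    · obtain ⟨q, -, rfl⟩ := Finset.mem_image.1 hx
      exact q.1.2
  · rcases eq_or_ne u 0 with rfl | hu
    · exact ⟨x₁, by simp, by simp⟩
    have hnu : 0 < ‖u‖ := norm_pos_iff.2 hu
    have := hI (show (‖u‖⁻¹ • u) ∈ Metric.sphere (0 : E n) 1 by
      simp [norm_smul, hnu.ne'])
    simp only [Set.mem_iUnion, Set.mem_ofPred_eq, real_inner_smul_right] at this
    obtain ⟨q, hq, hqu⟩ := this
    refine ⟨q.1.1, Finset.mem_insert_of_mem (Finset.mem_image_of_mem _ hq), ?_⟩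
    have hqM : ((M : ℝ) + 1)⁻¹ ≤ ((q.2 : ℝ) + 1)⁻¹ := by
      have : (q.2 : ℝ) ≤ M := by exact_mod_cast Finset.le_sup (f := Prod.snd) hq
      gcongr
    have := (hqM.trans hqu.le)
    rw [← div_eq_inv_mul, le_div_iff₀ hnu] at this
    exact this

/-- The function equal to `f` on the closed ball of radius `k` and to `⊤` outside. -/
noncomputable def trunc (f : E n → EReal) (k : ℝ) (x : E n) : EReal :=
  open Classical in if ‖x‖ ≤ k then f x else ⊤

theorem trunc_of_le {f : E n → EReal} {k : ℝ} {x : E n} (h : ‖x‖ ≤ k) : trunc f k x = f x :=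
  if_pos h

theorem trunc_of_lt {f : E n → EReal} {k : ℝ} {x : E n} (h : k < ‖x‖) : trunc f k x = ⊤ :=
  if_neg (not_le.2 h)

theorem le_trunc (f : E n → EReal) (k : ℝ) (x : E n) : f x ≤ trunc f k x := by
  unfold trunc; split_ifs <;> simp

/-- The lower bound uses only finitely many points of the domain, so it holds with the same
constants once the truncation ball contains them. -/
theorem exists_norm_le_conj_trunc {f : E n → EReal} (hf : ∃ x, f x ≠ ⊤)
    (h0 : 0 < expInt volume (conj f)) (h1 : expInt volume (conj f) ≠ ⊤) :
    ∃ δ M R : ℝ, 0 < δ ∧ ∀ k, R ≤ k → ∀ y, ((δ * ‖y‖ - M : ℝ) : EReal) ≤ conj (trunc f k) y := by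
  obtain ⟨s, δ, hδ, hs, h⟩ := exists_finset_inner_ge hf h0 h1
  have hsn : s.Nonempty := by obtain ⟨x, hx, -⟩ := h 0; exact ⟨x, hx⟩
  refine ⟨δ, s.sup' hsn fun x => (f x).toReal, s.sup' hsn fun x => ‖x‖, hδ, fun k hk y => ?_⟩
  obtain ⟨x, hx, hxy⟩ := h y
  have hxk : ‖x‖ ≤ k := (Finset.le_sup' (fun x => ‖x‖) hx).trans hk
  refine le_trans ?_ (le_conj _ x y)
  rw [trunc_of_le hxk]
  refine le_trans ?_ (EReal.sub_le_sub le_rfl (EReal.le_coe_toReal (hs x hx)))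
  have := Finset.le_sup' (fun x => (f x).toReal) hx
  norm_cast
  linarith

theorem exists_norm_le_conj {f : E n → EReal} (hf : ∃ x, f x ≠ ⊤)
    (h0 : 0 < expInt volume (conj f)) (h1 : expInt volume (conj f) ≠ ⊤) :
    ∃ δ M : ℝ, 0 < δ ∧ ∀ y, ((δ * ‖y‖ - M : ℝ) : EReal) ≤ conj f y := by
  obtain ⟨δ, M, R, hδ, h⟩ := exists_norm_le_conj_trunc hf h0 h1
  exact ⟨δ, M, hδ, fun y => (h R le_rfl y).trans (conj_anti (le_trunc f R) y)⟩

/-! ### Conjugates of truncations and their gradients -/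

theorem exists_attained_conj_trunc {f : E n → EReal} (hlsc : LowerSemicontinuous f)
    (hbot : ∀ x, f x ≠ ⊥) {k : ℝ} (hf : ∃ x, ‖x‖ ≤ k ∧ f x ≠ ⊤) (y : E n) :
    ∃ (x : E n) (v : ℝ), ‖x‖ ≤ k ∧ f x = ((inner ℝ x y - v : ℝ) : EReal) ∧
      conj (trunc f k) y = v := by
  obtain ⟨x₁, hx₁k, hx₁⟩ := hf
  have hl : LowerSemicontinuous fun x => f x + ((-inner ℝ x y : ℝ) : EReal) := by
    refine LowerSemicontinuous.add' hlsc (Continuous.lowerSemicontinuous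
      (continuous_coe_real_ereal.comp (by fun_prop))) fun x => ?_
    exact EReal.continuousAt_add (Or.inr (EReal.coe_ne_bot _)) (Or.inl (hbot x))
  obtain ⟨x, hxk, hx⟩ := (hl.lowerSemicontinuousOn (Metric.closedBall 0 k)).exists_isMinOn
    ⟨x₁, by simpa using hx₁k⟩ (isCompact_closedBall 0 k)
  rw [isMinOn_iff] at hx
  have hxk' : ‖x‖ ≤ k := by simpa using hxk
  have hxtop : f x ≠ ⊤ := by
    intro ht
    have := hx x₁ (by simpa using hx₁k)
    rw [ht, EReal.top_add_coe, top_le_iff] at this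
    obtain ⟨t₁, ht₁⟩ : ∃ t₁ : ℝ, f x₁ = t₁ := ⟨_, (EReal.coe_toReal hx₁ (hbot x₁)).symm⟩
    rw [ht₁] at this
    exact EReal.coe_ne_top (t₁ + -inner ℝ x₁ y) (by exact_mod_cast this)
  obtain ⟨t, ht⟩ : ∃ t : ℝ, f x = t := ⟨_, (EReal.coe_toReal hxtop (hbot x)).symm⟩
  refine ⟨x, inner ℝ x y - t, hxk', by rw [ht]; norm_cast; ring, le_antisymm ?_ ?_⟩
  · refine iSup_le fun z => ?_
    rcases le_or_gt ‖z‖ k with hz | hz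
    · rw [trunc_of_le hz]
      have := hx z (by simpa using hz)
      rw [ht] at this
      induction hfz : f z with
      | bot => exact absurd hfz (hbot z)
      | top => simp
      | coe r =>
        rw [hfz] at this
        norm_cast at this ⊢
        linarith
    · simp [trunc_of_lt hz]
  · refine le_trans (le_of_eq ?_) (le_conj _ x y)
    rw [trunc_of_le hxk', ht]
    norm_cast

/-- Truncation to a ball makes the conjugate finite and Lipschitz on the whole space, hence
differentiable almost everywhere, and gives maximizers, which are its subgradients. -/
theorem exists_conj_trunc {f : E n → EReal} (hlsc : LowerSemicontinuous f)
    (hbot : ∀ x, f x ≠ ⊥) {k : ℝ} (hf : ∃ x, ‖x‖ ≤ k ∧ f x ≠ ⊤) :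
    ∃ V : E n → ℝ, (∀ y, conj (trunc f k) y = V y) ∧ LipschitzWith k.toNNReal V ∧
      ∀ y, ∃ x, ‖x‖ ≤ k ∧ f x = ((inner ℝ x y - V y : ℝ) : EReal) := by
  choose X V hX hfX hV using exists_attained_conj_trunc hlsc hbot hf
  refine ⟨V, hV, ?_, fun y => ⟨X y, hX y, hfX y⟩⟩
  refine LipschitzWith.of_le_add_mul _ fun y z => ?_
  have h1 := le_conj (trunc f k) (X y) z
  rw [trunc_of_le (hX y), hfX y, hV z] at h1
  have h2 : inner ℝ (X y) y - inner ℝ (X y) z ≤ k * dist y z := by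
    rw [← inner_sub_right, dist_eq_norm]
    exact (real_inner_le_norm _ _).trans (mul_le_mul_of_nonneg_right (hX y) (norm_nonneg _))
  rw [Real.coe_toNNReal _ ((norm_nonneg _).trans (hX y))]
  norm_cast at h1
  linarith

theorem gradient_of_forall_le {V : E n → ℝ} {x y : E n} (hd : DifferentiableAt ℝ V y)
    (h : ∀ z, V y + inner ℝ x (z - y) ≤ V z) : gradient V y = x := by
  have hmin : IsLocalMin (fun z => V z - inner ℝ x z) y :=
    Filter.Eventually.of_forall fun z => by
      have := h z
      rw [inner_sub_right] at this
      simp only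
      linarith
  have h1 : HasFDerivAt (fun z => V z - inner ℝ x z) (fderiv ℝ V y - innerSL ℝ x) y :=
    hd.hasFDerivAt.sub (innerSL ℝ x).hasFDerivAt
  have h2 := hmin.hasFDerivAt_eq_zero h1
  rw [gradient, sub_eq_zero.1 h2]
  exact (LinearIsometryEquiv.symm_apply_eq _).2 rfl

/-! ### Integrals of extended real functions and bounds on the twisted entropy -/

theorem posInt_neg (ν : Measure (E n)) (g : E n → EReal) :
    posInt ν (fun x => -(g x)) = negInt ν g := rfl

theorem negInt_neg (ν : Measure (E n)) (g : E n → EReal) :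
    negInt ν (fun x => -(g x)) = posInt ν g := by
  simp only [negInt, posInt, neg_neg]

theorem ae_ne_top {ν : Measure (E n)} {g : E n → EReal} (hg : Measurable g)
    (hp : posInt ν g < ⊤) : ∀ᵐ x ∂ν, g x ≠ ⊤ := by
  filter_upwards [ae_lt_top hg.ereal_toENNReal hp.ne] with x hx h
  simp [h] at hx

theorem ae_ne_bot {ν : Measure (E n)} {g : E n → EReal} (hg : Measurable g)
    (hn : negInt ν g < ⊤) : ∀ᵐ x ∂ν, g x ≠ ⊥ := by
  filter_upwards [ae_ne_top (g := fun x => -(g x)) hg.neg hn] with x hx h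
  simp [h] at hx

theorem posInt_eq {ν : Measure (E n)} {g : E n → EReal} (h : ∀ᵐ x ∂ν, g x ≠ ⊤) :
    posInt ν g = ∫⁻ x, ENNReal.ofReal (g x).toReal ∂ν := by
  refine lintegral_congr_ae ?_
  filter_upwards [h] with x hx
  rw [EReal.toENNReal_of_ne_top hx]

theorem negInt_eq {ν : Measure (E n)} {g : E n → EReal} (h : ∀ᵐ x ∂ν, g x ≠ ⊥) :
    negInt ν g = ∫⁻ x, ENNReal.ofReal (-(g x).toReal) ∂ν := by
  have : ∀ᵐ x ∂ν, -(g x) ≠ ⊤ := by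
    filter_upwards [h] with x hx hx'
    exact hx (by simpa using hx')
  rw [← posInt_neg, posInt_eq this]
  simp

theorem integrable_toReal {ν : Measure (E n)} {g : E n → EReal} (hg : Measurable g)
    (hp : posInt ν g < ⊤) (hn : negInt ν g < ⊤) : Integrable (fun x => (g x).toReal) ν := by
  refine ⟨hg.ereal_toReal.aestronglyMeasurable, ?_⟩
  rw [hasFiniteIntegral_iff_norm]
  have : ∀ x, ENNReal.ofReal ‖(g x).toReal‖ =
      ENNReal.ofReal (g x).toReal + ENNReal.ofReal (-(g x).toReal) := fun x => by
    rcases le_total 0 (g x).toReal with h | h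
    · rw [ENNReal.ofReal_of_nonpos (p := -(g x).toReal) (by linarith), Real.norm_of_nonneg h, add_zero]
    · rw [ENNReal.ofReal_of_nonpos h, Real.norm_of_nonpos h, zero_add]
  simp only [this]
  rw [lintegral_add_left hg.ereal_toReal.ennreal_ofReal, ← posInt_eq (ae_ne_top hg hp),
    ← negInt_eq (ae_ne_bot hg hn)]
  exact ENNReal.add_lt_top.2 ⟨hp, hn⟩

theorem posInt_lt_top_of_integrable {ν : Measure (E n)} {g : E n → EReal}
    (h : ∀ᵐ x ∂ν, g x ≠ ⊤) (hi : Integrable (fun x => (g x).toReal) ν) : posInt ν g < ⊤ := by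
  rw [posInt_eq h]
  exact hi.lintegral_lt_top

theorem negInt_lt_top_of_integrable {ν : Measure (E n)} {g : E n → EReal}
    (h : ∀ᵐ x ∂ν, g x ≠ ⊥) (hi : Integrable (fun x => (g x).toReal) ν) : negInt ν g < ⊤ := by
  rw [negInt_eq h]
  exact hi.neg.lintegral_lt_top

theorem eInt_eq_integral {ν : Measure (E n)} {g : E n → EReal} (hg : Measurable g)
    (hp : posInt ν g < ⊤) (hn : negInt ν g < ⊤) :
    eInt ν g = ((∫ x, (g x).toReal ∂ν : ℝ) : EReal) := by
  rw [integral_eq_lintegral_pos_part_sub_lintegral_neg_part (integrable_toReal hg hp hn),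
    ← posInt_eq (ae_ne_top hg hp), ← negInt_eq (ae_ne_bot hg hn), eInt, EReal.coe_sub,
    EReal.coe_ennreal_toReal hp.ne, EReal.coe_ennreal_toReal hn.ne]

theorem measurable_of_mem_F {f : E n → EReal} (hf : f ∈ F n) : Measurable f := hf.1.measurable

theorem eInt_neg_sub_L {ν : Measure (E n)} {g : E n → EReal} (hg : g ∈ FL1 ν) (m : Measure (E n)) :
    eInt ν (fun x => -(g x)) - L g m =
      ((-∫ x, (g x).toReal ∂ν : ℝ) : EReal) + ENNReal.log (expInt m (conj g)) := by
  rw [eInt_eq_integral (g := fun x => -(g x)) (measurable_of_mem_F hg.1).neg (by rw [posInt_neg]; exact hg.2.2)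
    (by rw [negInt_neg]; exact hg.2.1), L, sub_eq_add_neg, neg_neg]
  simp [integral_neg]

theorem le_K {ν : Measure (E n)} {g : E n → EReal} (hg : g ∈ FL1 ν) (m : Measure (E n)) :
    ((-∫ x, (g x).toReal ∂ν : ℝ) : EReal) + ENNReal.log (expInt m (conj g)) ≤ K ν m := by
  rw [← eInt_neg_sub_L hg]
  exact le_iSup₂ (f := fun g _ => eInt ν (fun x => -(g x)) - L g m) g hg

theorem log_ofReal_exp (x : ℝ) : ENNReal.log (ENNReal.ofReal (Real.exp x)) = x := by
  rw [ENNReal.log_ofReal_of_pos (Real.exp_pos x), Real.log_exp]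

theorem K_le {ν m : Measure (E n)} {B : ℝ}
    (h : ∀ g ∈ FL1 ν, expInt m (conj g) ≤
      ENNReal.ofReal (Real.exp ((∫ x, (g x).toReal ∂ν) + B))) : K ν m ≤ B := by
  refine iSup₂_le fun g hg => ?_
  rw [eInt_neg_sub_L hg]
  have := ENNReal.log_monotone (h g hg)
  rw [log_ofReal_exp] at this
  refine (add_le_add le_rfl this).trans (le_of_eq ?_)
  norm_cast
  ring

/-! ### Exponential integrals, Gibbs measures and the first order form of Prékopa-Leindler -/

theorem integrable_one_add_norm_mul_exp {δ : ℝ} (hδ : 0 < δ) :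
    Integrable (fun y : E n => (1 + ‖y‖) * Real.exp (-(δ * ‖y‖))) := by
  -- Decay of order `n + 1` is integrable in dimension `n`; bounding the exponential by its term of
  -- degree `n + 2` leaves one power for the factor `1 + ‖y‖`.
  have h1 := (integrable_one_add_norm (E := E n) (μ := volume) (r := (n + 1 : ℕ)) (by simp)).const_mul
    (Real.exp δ * (n + 2).factorial / δ ^ (n + 2))
  refine h1.mono' (by fun_prop) (Filter.Eventually.of_forall fun y => ?_)
  have hr : 0 < 1 + ‖y‖ := by positivity
  have h2 := Real.pow_div_factorial_le_exp (δ * (1 + ‖y‖)) (by positivity) (n + 2)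
  rw [Real.norm_of_nonneg (by positivity), Real.rpow_neg hr.le, Real.rpow_natCast, Real.exp_neg,
    ← div_eq_mul_inv, ← div_eq_mul_inv, div_div, div_le_div_iff₀ (Real.exp_pos _) (by positivity)]
  rw [div_le_iff₀ (by positivity), mul_pow, mul_add, mul_one, Real.exp_add] at h2
  calc (1 + ‖y‖) * (δ ^ (n + 2) * (1 + ‖y‖) ^ (n + 1)) = δ ^ (n + 2) * (1 + ‖y‖) ^ (n + 2) := by ring
    _ ≤ _ := h2
    _ = _ := by ring

theorem abs_exp_sub_one_le (s : ℝ) : |Real.exp s - 1| ≤ |s| * Real.exp (max s 0) := by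
  rcases le_total 0 s with h | h
  · have h1 := Real.add_one_le_exp (-s)
    have h2 : Real.exp (-s) * Real.exp s = 1 := by rw [← Real.exp_add]; simp
    rw [max_eq_left h, abs_of_nonneg h, abs_of_nonneg (by linarith [Real.add_one_le_exp s])]
    nlinarith [Real.exp_pos s]
  · have h1 := Real.add_one_le_exp s
    have h2 : Real.exp s ≤ 1 := Real.exp_le_one_iff.2 h
    rw [max_eq_right h, abs_of_nonpos h, abs_of_nonpos (by linarith), Real.exp_zero]
    linarith

/-- Differentiation under the integral at `t = 0⁺`. The upper bound on `h` makes `|h| e^{max(C, 0)}`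
a dominating function for `0 < t < 1`; no lower bound is needed. -/
theorem tendsto_integral_exp_sub_one_div {α : Type*} [MeasurableSpace α] {μ : Measure α}
    {h : α → ℝ} (hi : Integrable h μ) {C : ℝ} (hC : ∀ᵐ x ∂μ, h x ≤ C) :
    Filter.Tendsto (fun t : ℝ => ∫ x, (Real.exp (t * h x) - 1) / t ∂μ) (nhdsWithin 0 (Set.Ioi 0))
      (nhds (∫ x, h x ∂μ)) := by
  refine tendsto_integral_filter_of_dominated_convergence (fun x => |h x| * Real.exp (max C 0))
    (Filter.Eventually.of_forall fun t => ?_) ?_ (hi.abs.mul_const _) ?_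
  · simp only [div_eq_mul_inv]
    exact ((Real.continuous_exp.comp_aestronglyMeasurable
      (hi.aestronglyMeasurable.const_mul t)).sub aestronglyMeasurable_const).mul_const _
  · filter_upwards [Ioo_mem_nhdsGT one_pos] with t ht
    filter_upwards [hC] with x hx
    rw [Real.norm_eq_abs, abs_div, abs_of_pos ht.1, div_le_iff₀ ht.1]
    refine (abs_exp_sub_one_le _).trans ?_
    rw [abs_mul, abs_of_pos ht.1]
    have : max (t * h x) 0 ≤ max C 0 := by
      refine max_le ?_ (le_max_right _ _)
      rcases le_total 0 (h x) with h0 | h0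
      · exact le_max_of_le_left (by nlinarith [ht.2])
      · exact le_max_of_le_right (mul_nonpos_of_nonneg_of_nonpos ht.1.le h0)
    calc t * |h x| * Real.exp (max (t * h x) 0) ≤ t * |h x| * Real.exp (max C 0) := by
          refine mul_le_mul_of_nonneg_left (Real.exp_le_exp.2 this) ?_
          exact mul_nonneg ht.1.le (abs_nonneg _)
      _ = _ := by ring
  · refine Filter.Eventually.of_forall fun x => ?_
    have hd : HasDerivAt (fun t : ℝ => Real.exp (t * h x)) (h x) 0 := by
      simpa using ((hasDerivAt_id (0 : ℝ)).mul_const (h x)).exp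
    have := (hasDerivAt_iff_tendsto_slope.1 hd).mono_left
      (nhdsWithin_mono 0 (fun t (ht : 0 < t) => ht.ne'))
    refine this.congr fun t => ?_
    simp [slope_def_field]

theorem integrable_exp_mul {α : Type*} [MeasurableSpace α] {μ : Measure α} [IsProbabilityMeasure μ]
    {h : α → ℝ} (hi : Integrable h μ) {C : ℝ} (hC : ∀ᵐ x ∂μ, h x ≤ C) {t : ℝ} (ht : 0 ≤ t) :
    Integrable (fun x => Real.exp (t * h x)) μ := by
  refine (integrable_const (Real.exp (t * C))).mono'
    (Real.continuous_exp.comp_aestronglyMeasurable (hi.aestronglyMeasurable.const_mul t)) ?_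
  filter_upwards [hC] with x hx
  rw [Real.norm_of_nonneg (Real.exp_pos _).le]
  exact Real.exp_le_exp.2 (mul_le_mul_of_nonneg_left hx ht)

/-- The measure with density `exp (-(V + ℓ))`. -/
noncomputable def gibbs (V : E n → ℝ) (ℓ : ℝ) : Measure (E n) :=
  volume.withDensity fun y => ENNReal.ofReal (Real.exp (-(V y + ℓ)))

theorem lintegral_gibbs {V : E n → ℝ} (hV : Measurable V) (ℓ : ℝ) {q : E n → ENNReal}
    (hq : Measurable q) :
    ∫⁻ y, q y ∂(gibbs V ℓ) =
      ENNReal.ofReal (Real.exp (-ℓ)) * ∫⁻ y, ENNReal.ofReal (Real.exp (-V y)) * q y := by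
  rw [gibbs, lintegral_withDensity_eq_lintegral_mul _ (by fun_prop) hq,
    ← lintegral_const_mul _ (by fun_prop)]
  refine lintegral_congr fun y => ?_
  rw [Pi.mul_apply, ← mul_assoc, ← ENNReal.ofReal_mul (Real.exp_pos _).le, ← Real.exp_add]
  congr 4
  ring

theorem isProbabilityMeasure_gibbs {V : E n → ℝ} (hV : Measurable V) {ℓ : ℝ}
    (hℓ : ∫⁻ y, ENNReal.ofReal (Real.exp (-V y)) = ENNReal.ofReal (Real.exp ℓ)) :
    IsProbabilityMeasure (gibbs V ℓ) := by
  constructor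
  have := lintegral_gibbs hV ℓ (q := fun _ => 1) measurable_const
  simp only [lintegral_const, one_mul, mul_one, hℓ] at this
  rw [this, ← ENNReal.ofReal_mul (Real.exp_pos _).le, ← Real.exp_add]
  simp

/-- First order consequence of the Prékopa-Leindler inequality. -/
theorem log_le_integral_gibbs {V : E n → ℝ} (hV : Measurable V) {ℓ : ℝ}
    (hℓ : ∫⁻ y, ENNReal.ofReal (Real.exp (-V y)) = ENNReal.ofReal (Real.exp ℓ))
    {h : E n → ℝ} (hh : Measurable h) (hi : Integrable h (gibbs V ℓ)) {C : ℝ}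
    (hC : ∀ᵐ x ∂(gibbs V ℓ), h x ≤ C) {ψ : E n → EReal} (hψ : Measurable ψ)
    (hψbot : ∀ y, ψ y ≠ ⊥) {w : ℝ} (hw : expInt volume ψ = ENNReal.ofReal (Real.exp w))
    {N : Set (E n)} (hN : MeasurableSet N) (hN0 : volume N = 0)
    (H : ∀ t a b s, 0 < t → t < 1 → (1 - t) • a + t • b ∉ N → ψ b = ((s : ℝ) : EReal) →
      V ((1 - t) • a + t • b) - t * h ((1 - t) • a + t • b) ≤ (1 - t) * V a + t * s) :
    w ≤ (∫ y, h y ∂(gibbs V ℓ)) + ℓ := by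
  classical
  have hprob := isProbabilityMeasure_gibbs hV hℓ
  have key : ∀ t : ℝ, 0 < t → t < 1 →
      Real.exp (t * (w - ℓ)) ≤ ∫ y, Real.exp (t * h y) ∂(gibbs V ℓ) := fun t ht0 ht1 => by
    have ht1' : 0 < 1 - t := by linarith
    have hexpi := integrable_exp_mul hi hC ht0.le
    -- Setting the third function to `⊤` on the null set `N` makes the Prékopa-Leindler hypothesis
    -- trivial there without changing its integral.
    have hae : ∀ᵐ z : E n, (if z ∈ N then ⊤ else ENNReal.ofReal (Real.exp (-V z + t * h z))) =
        ENNReal.ofReal (Real.exp (-V z)) * ENNReal.ofReal (Real.exp (t * h z)) := by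
      filter_upwards [measure_eq_zero_iff_ae_notMem.1 hN0] with z hz
      rw [if_neg hz, Real.exp_add, ENNReal.ofReal_mul (Real.exp_pos _).le]
    have pl := prekopa_leindler ht0 ht1 (f := fun y => ENNReal.ofReal (Real.exp (-V y)))
      (g := fun y => EReal.exp (-(ψ y)))
      (h := fun z => if z ∈ N then ⊤ else ENNReal.ofReal (Real.exp (-V z + t * h z)))
      (by fun_prop) hψ.neg.ereal_exp (Measurable.ite hN measurable_const (by fun_prop)) ?_
    · rw [lintegral_congr_ae hae, hℓ, show ∫⁻ y, EReal.exp (-(ψ y)) = _ from hw,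
        ENNReal.ofReal_rpow_of_pos (Real.exp_pos _), ENNReal.ofReal_rpow_of_pos (Real.exp_pos _),
        ← Real.exp_mul, ← Real.exp_mul, ← ENNReal.ofReal_mul (Real.exp_pos _).le,
        ← Real.exp_add] at pl
      have e := lintegral_gibbs hV ℓ (q := fun y => ENNReal.ofReal (Real.exp (t * h y)))
        (by fun_prop)
      rw [← ofReal_integral_eq_lintegral_ofReal hexpi
        (Filter.Eventually.of_forall fun y => (Real.exp_pos _).le)] at e
      have pl' := mul_le_mul_right pl (ENNReal.ofReal (Real.exp (-ℓ)))
      rw [← e, ← ENNReal.ofReal_mul (Real.exp_pos _).le, ← Real.exp_add,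
        ENNReal.ofReal_le_ofReal_iff (integral_nonneg fun y => (Real.exp_pos _).le)] at pl'
      refine le_trans (le_of_eq ?_) pl'
      congr 1
      ring
    · intro a b
      by_cases hz : (1 - t) • a + t • b ∈ N
      · simp [hz]
      rw [if_neg hz]
      induction hb : ψ b with
      | bot => exact absurd hb (hψbot b)
      | top => simp [ht0]
      | coe s =>
        rw [← EReal.coe_neg, EReal.exp_coe, ENNReal.ofReal_rpow_of_pos (Real.exp_pos _),
          ENNReal.ofReal_rpow_of_pos (Real.exp_pos _), ← Real.exp_mul, ← Real.exp_mul,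
          ← ENNReal.ofReal_mul (Real.exp_pos _).le, ← Real.exp_add]
        refine ENNReal.ofReal_le_ofReal (Real.exp_le_exp.2 ?_)
        have := H t a b s ht0 ht1 hz hb
        linarith
  have hlim := tendsto_integral_exp_sub_one_div hi hC
  -- Since `e^x ≥ 1 + x`, the inequality `key` bounds `w - ℓ` by the difference quotient, for every
  -- `t` in `(0, 1)`.
  have : w - ℓ ≤ ∫ y, h y ∂(gibbs V ℓ) := by
    refine ge_of_tendsto hlim ?_
    filter_upwards [Ioo_mem_nhdsGT one_pos] with t ht
    rw [integral_div, integral_sub (integrable_exp_mul hi hC ht.1.le) (integrable_const 1),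
      le_div_iff₀ ht.1]
    have h1 := key t ht.1 ht.2
    have h2 := Real.add_one_le_exp (t * (w - ℓ))
    simp only [integral_const, probReal_univ, smul_eq_mul, mul_one]
    linarith
  linarith

theorem integrable_exp_neg_mul {V p : E n → ℝ} (hV : Measurable V) (hp : Measurable p) {δ M C : ℝ}
    (hδ : 0 < δ) (hVle : ∀ y, δ * ‖y‖ - M ≤ V y) (hpC : ∀ y, |p y| ≤ C * (1 + ‖y‖)) :
    Integrable fun y => Real.exp (-V y) * p y := by
  refine ((integrable_one_add_norm_mul_exp hδ).const_mul (C * Real.exp M)).mono' (by fun_prop)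
    (Filter.Eventually.of_forall fun y => ?_)
  rw [norm_mul, Real.norm_of_nonneg (Real.exp_pos _).le, Real.norm_eq_abs]
  have h1 : Real.exp (-V y) ≤ Real.exp M * Real.exp (-(δ * ‖y‖)) := by
    rw [← Real.exp_add]
    exact Real.exp_le_exp.2 (by linarith [hVle y])
  calc Real.exp (-V y) * |p y| ≤ (Real.exp M * Real.exp (-(δ * ‖y‖))) * (C * (1 + ‖y‖)) :=
        mul_le_mul h1 (hpC y) (abs_nonneg _) (by positivity)
    _ = _ := by ring

theorem integrable_gibbs {V p : E n → ℝ} (hV : Measurable V) (hp : Measurable p) {δ M C : ℝ}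
    (hδ : 0 < δ) (hVle : ∀ y, δ * ‖y‖ - M ≤ V y) (hpC : ∀ y, |p y| ≤ C * (1 + ‖y‖)) (ℓ : ℝ) :
    Integrable p (gibbs V ℓ) := by
  rw [gibbs, integrable_withDensity_iff_integrable_smul' (by fun_prop)
    (Filter.Eventually.of_forall fun y => ENNReal.ofReal_lt_top)]
  refine ((integrable_exp_neg_mul hV hp hδ hVle hpC).const_mul (Real.exp (-ℓ))).congr
    (Filter.Eventually.of_forall fun y => ?_)
  simp only [smul_eq_mul]
  rw [ENNReal.toReal_ofReal (Real.exp_pos _).le, ← mul_assoc, ← Real.exp_add]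
  congr 2
  ring

theorem exists_lintegral_exp_neg_eq {V : E n → ℝ} (hV : Measurable V) {δ M : ℝ}
    (hδ : 0 < δ) (hVle : ∀ y, δ * ‖y‖ - M ≤ V y) :
    ∃ ℓ : ℝ, ∫⁻ y, ENNReal.ofReal (Real.exp (-V y)) = ENNReal.ofReal (Real.exp ℓ) := by
  have hi := integrable_exp_neg_mul (p := fun _ => 1) (C := 1) hV measurable_const hδ hVle
    (fun y => by simp)
  simp only [mul_one] at hi
  have hfin := hi.lintegral_lt_top
  have hpos : 0 < ∫⁻ y, ENNReal.ofReal (Real.exp (-V y)) := by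
    rw [lintegral_pos_iff_support (by fun_prop)]
    have : (Function.support fun y => ENNReal.ofReal (Real.exp (-V y))) = Set.univ := by
      ext y; simp [Real.exp_pos]
    rw [this]
    exact Measure.measure_univ_pos.2 (NeZero.ne _)
  refine ⟨Real.log (∫⁻ y, ENNReal.ofReal (Real.exp (-V y))).toReal, ?_⟩
  rw [Real.exp_log (ENNReal.toReal_pos hpos.ne' hfin.ne), ENNReal.ofReal_toReal hfin.ne]

theorem measurable_gradient (V : E n → ℝ) : Measurable (gradient V) :=
  (LinearIsometryEquiv.continuous _).measurable.comp (measurable_fderiv ℝ V)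

theorem norm_gradient_le {V : E n → ℝ} {k : ℝ} (hk : 0 ≤ k) (hV : LipschitzWith k.toNNReal V)
    (z : E n) : ‖gradient V z‖ ≤ k := by
  rw [gradient, LinearIsometryEquiv.norm_map]
  simpa [hk] using norm_fderiv_le_of_lipschitz ℝ hV (x₀ := z)

theorem gradient_map {V : E n → ℝ} {A : E n ≃ₗᵢ[ℝ] E n} (h : ∀ y, V (A y) = V y) (y : E n) :
    gradient V (A y) = A (gradient V y) := by
  have h1 : fderiv ℝ V y = (fderiv ℝ V (A y)).comp (A.toContinuousLinearEquiv : E n →L[ℝ] E n) := by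
    have := A.toContinuousLinearEquiv.comp_right_fderiv (f := V) (x := y)
    rwa [show V ∘ A.toContinuousLinearEquiv = V from funext h] at this
  refine ext_inner_right ℝ fun v => ?_
  rw [show inner ℝ (A (gradient V y)) v = inner ℝ (gradient V y) (A.symm v) by
    rw [← A.inner_map_map (gradient V y) (A.symm v), A.apply_symm_apply]]
  simp only [gradient, InnerProductSpace.toDual_symm_apply]
  rw [h1]
  simp

theorem abs_le_of_lipschitz {V : E n → ℝ} {k : ℝ} (hk : 0 ≤ k) (hV : LipschitzWith k.toNNReal V)
    (y : E n) : |V y| ≤ |V 0| + k * ‖y‖ := by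
  have h := hV.dist_le_mul y 0
  rw [Real.coe_toNNReal _ hk, dist_zero_right, Real.dist_eq] at h
  have := abs_add_le (V y - V 0) (V 0)
  rw [sub_add_cancel] at this
  linarith

theorem gibbs_map {V : E n → ℝ} (hV : Measurable V) (ℓ : ℝ) {A : E n ≃ₗᵢ[ℝ] E n}
    (h : ∀ y, V (A y) = V y) : (gibbs V ℓ).map A = gibbs V ℓ := by
  have hA : Measurable A := A.continuous.measurable
  ext s hs
  rw [Measure.map_apply hA hs, gibbs, withDensity_apply _ (hA hs), withDensity_apply _ hs,
    ← A.measurePreserving.setLIntegral_comp_preimage hs (by fun_prop)]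
  simp only [h]

theorem conj_trunc_map {f : E n → EReal} (k : ℝ) {A : E n ≃ₗᵢ[ℝ] E n} (h : ∀ x, f (A x) = f x)
    (y : E n) : conj (trunc f k) (A y) = conj (trunc f k) y := by
  unfold conj
  refine (A.toEquiv.surjective.iSup_comp _).symm.trans (iSup_congr fun x => ?_)
  simp [trunc, h]

theorem measurable_trunc {g : E n → EReal} (hg : Measurable g) (k : ℝ) : Measurable (trunc g k) :=
  Measurable.ite (measurableSet_le measurable_norm measurable_const) hg measurable_const

/-- Monotone convergence; it allows `g*` to be replaced by its truncations, whose conjugates are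
finite and Lipschitz. -/
theorem expInt_le_of_forall_trunc {g : E n → EReal} (hg : Measurable g) {X : ENNReal}
    (h : ∀ m : ℕ, expInt volume (trunc g m) ≤ X) : expInt volume g ≤ X := by
  have key : Filter.Tendsto (fun m : ℕ => expInt volume (trunc g m)) Filter.atTop
      (nhds (expInt volume g)) := by
    refine lintegral_tendsto_of_tendsto_of_monotone (fun m => ?_) ?_ ?_
    · exact (measurable_trunc hg m).neg.ereal_exp.aemeasurable
    · refine Filter.Eventually.of_forall fun x i j hij => ?_
      rw [EReal.exp_le_exp_iff, EReal.neg_le_neg_iff]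
      have hij' : (i : ℝ) ≤ j := by exact_mod_cast hij
      rcases le_or_gt ‖x‖ (i : ℝ) with hx | hx
      · rw [trunc_of_le hx, trunc_of_le (hx.trans hij')]
      · rw [trunc_of_lt hx]; exact le_top
    · refine Filter.Eventually.of_forall fun x => ?_
      obtain ⟨m, hm⟩ := exists_nat_ge ‖x‖
      refine tendsto_const_nhds.congr' ?_
      filter_upwards [Filter.eventually_ge_atTop m] with j hj
      rw [trunc_of_le (hm.trans (by exact_mod_cast hj))]
  exact le_of_tendsto' key h

theorem expInt_trunc_lt_top {g : E n → EReal} {m : ℝ} {B : ℝ}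
    (h : ∀ y, ((-B : ℝ) : EReal) ≤ trunc g m y) : expInt volume (trunc g m) < ⊤ := by
  have hle : expInt volume (trunc g m) ≤
      ∫⁻ y, (Metric.closedBall (0 : E n) m).indicator
        (fun _ => ENNReal.ofReal (Real.exp B)) y := by
    refine lintegral_mono fun y => ?_
    by_cases hy : ‖y‖ ≤ m
    · rw [Set.indicator_of_mem (by simpa using hy), ← EReal.exp_coe, EReal.exp_le_exp_iff,
        EReal.neg_le]
      simpa using h y
    · rw [trunc_of_lt (not_le.1 hy)]; simp
  refine hle.trans_lt ?_
  rw [lintegral_indicator_const measurableSet_closedBall]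
  exact ENNReal.mul_lt_top ENNReal.ofReal_lt_top (isCompact_closedBall _ _).measure_lt_top

/-! ### The moment measure and its twisted entropy -/

section Moment

variable {f : E n → EReal} {k δ M ℓ : ℝ} {V : E n → ℝ}

/-- A point attaining the supremum in the conjugate at `z` is a subgradient of `V` there, so it
equals `∇V(z)` when `V` is differentiable; this is the equality case of Fenchel-Young. -/
theorem apply_gradient
    (hV : ∀ y, conj (trunc f k) y = V y)
    (hatt : ∀ y, ∃ x, ‖x‖ ≤ k ∧ f x = ((inner ℝ x y - V y : ℝ) : EReal)) {z : E n}
    (hz : DifferentiableAt ℝ V z) :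
    f (gradient V z) = ((inner ℝ (gradient V z) z - V z : ℝ) : EReal) ∧
      ∀ y, V z + inner ℝ (gradient V z) (y - z) ≤ V y := by
  obtain ⟨x, hx, hfx⟩ := hatt z
  have hle : ∀ y, V z + inner ℝ x (y - z) ≤ V y := fun y => by
    have := le_conj (trunc f k) x y
    rw [trunc_of_le hx, hfx, hV] at this
    norm_cast at this
    rw [inner_sub_right]
    linarith
  rw [gradient_of_forall_le hz hle]
  exact ⟨hfx, hle⟩

theorem abs_inner_gradient_sub_le (hk : 0 ≤ k) (hLip : LipschitzWith k.toNNReal V) (z : E n) :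
    |inner ℝ (gradient V z) z - V z| ≤ (|V 0| + 2 * k) * (1 + ‖z‖) := by
  have h1 := abs_le_of_lipschitz hk hLip z
  have h2 : |inner ℝ (gradient V z) z| ≤ k * ‖z‖ :=
    (abs_real_inner_le_norm _ _).trans
      (mul_le_mul_of_nonneg_right (norm_gradient_le hk hLip z) (norm_nonneg z))
  have h3 := abs_sub (inner ℝ (gradient V z) z) (V z)
  nlinarith [norm_nonneg z, abs_nonneg (V 0)]

theorem ae_gibbs_of_ae {p : E n → Prop} (h : ∀ᵐ z, p z) : ∀ᵐ z ∂(gibbs V ℓ), p z :=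
  (withDensity_absolutelyContinuous _ _).ae_le h

theorem ae_map_apply_gradient (hlsc : LowerSemicontinuous f)
    (hV : ∀ y, conj (trunc f k) y = V y) (hLip : LipschitzWith k.toNNReal V)
    (hatt : ∀ y, ∃ x, ‖x‖ ≤ k ∧ f x = ((inner ℝ x y - V y : ℝ) : EReal)) :
    ∀ᵐ x ∂((gibbs V ℓ).map (gradient V)), f x ≠ ⊤ := by
  refine (ae_map_iff (p := fun x => f x ≠ ⊤) (measurable_gradient V).aemeasurable
    ((hlsc.measurable (measurableSet_singleton ⊤)).compl)).2 (ae_gibbs_of_ae ?_)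
  filter_upwards [hLip.ae_differentiableAt] with z hz
  rw [(apply_gradient hV hatt hz).1]
  exact EReal.coe_ne_top _

theorem integrable_toReal_map_gradient (hlsc : LowerSemicontinuous f) (hk : 0 ≤ k) (hδ : 0 < δ)
    (hVle : ∀ y, δ * ‖y‖ - M ≤ V y)
    (hV : ∀ y, conj (trunc f k) y = V y) (hLip : LipschitzWith k.toNNReal V)
    (hatt : ∀ y, ∃ x, ‖x‖ ≤ k ∧ f x = ((inner ℝ x y - V y : ℝ) : EReal)) :
    Integrable (fun x => (f x).toReal) ((gibbs V ℓ).map (gradient V)) ∧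
    ∫ x, (f x).toReal ∂((gibbs V ℓ).map (gradient V)) =
      ∫ z, (inner ℝ (gradient V z) z - V z) ∂(gibbs V ℓ) := by
  have hVm : Measurable V := hLip.continuous.measurable
  have hgm := measurable_gradient V
  have hae : ∀ᵐ z ∂(gibbs V ℓ),
      inner ℝ (gradient V z) z - V z = (f (gradient V z)).toReal := by
    refine ae_gibbs_of_ae ?_
    filter_upwards [hLip.ae_differentiableAt] with z hz
    rw [(apply_gradient hV hatt hz).1, EReal.toReal_coe]
  have hfm : AEStronglyMeasurable (fun x => (f x).toReal) ((gibbs V ℓ).map (gradient V)) :=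
    hlsc.measurable.ereal_toReal.aestronglyMeasurable
  constructor
  · rw [integrable_map_measure hfm hgm.aemeasurable]
    exact (integrable_gibbs hVm (by fun_prop) hδ hVle
      (abs_inner_gradient_sub_le hk hLip) ℓ).congr hae
  · rw [integral_map hgm.aemeasurable hfm]
    exact (integral_congr_ae hae).symm

/-- For `z = (1-t)a + tb` and `x = ∇V(z)`, combine `V(a) ≥ V(z) + ⟨x, a - z⟩`, `g*(b) ≥ ⟨b, x⟩ -
g(x)` and `f(x) = ⟨x, z⟩ - V(z)` to get `(1-t)V(a) + t g*(b) ≥ V(z) - t (g(x) - f(x))`. The first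
order form of Prékopa-Leindler then bounds `log ∫ e^{-g*}`. -/
theorem K_map_gradient_le (hf : f ∈ F n) (hk : 0 ≤ k) (hδ : 0 < δ)
    (hVle : ∀ y, δ * ‖y‖ - M ≤ V y)
    (hℓ : ∫⁻ y, ENNReal.ofReal (Real.exp (-V y)) = ENNReal.ofReal (Real.exp ℓ))
    (hV : ∀ y, conj (trunc f k) y = V y) (hLip : LipschitzWith k.toNNReal V)
    (hatt : ∀ y, ∃ x, ‖x‖ ≤ k ∧ f x = ((inner ℝ x y - V y : ℝ) : EReal)) :
    K ((gibbs V ℓ).map (gradient V)) volume ≤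
      ((ℓ - ∫ x, (f x).toReal ∂((gibbs V ℓ).map (gradient V)) : ℝ) : EReal) := by
  have hVm : Measurable V := hLip.continuous.measurable
  have hgm := measurable_gradient V
  have hprob := isProbabilityMeasure_gibbs hVm hℓ
  refine K_le fun g hg => expInt_le_of_forall_trunc (measurable_conj g) fun m => ?_
  rcases eq_or_ne (expInt volume (trunc (conj g) m)) 0 with h0 | h0
  · rw [h0]; exact zero_le
  have hcg := conj_mem_F hg.1
  have hne : ∃ y, ‖y‖ ≤ m ∧ conj g y ≠ ⊤ := by
    by_contra! hne
    refine h0 ?_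
    have : ∀ y, trunc (conj g) m y = ⊤ := fun y => by
      rcases le_or_gt ‖y‖ (m : ℝ) with hy | hy
      · rw [trunc_of_le hy, hne y hy]
      · exact trunc_of_lt hy
    simp [expInt, this]
  -- `G` replaces `g`: it is real-valued, Lipschitz and below `g`, so it is bounded on the bounded
  -- range of `∇V`.
  obtain ⟨G, hG, hGLip, -⟩ := exists_conj_trunc hcg.1 hcg.2.2.1 hne
  have hm0 : (0 : ℝ) ≤ m := Nat.cast_nonneg m
  have hGm : Measurable G := hGLip.continuous.measurable
  have hGle : ∀ x, (G x : EReal) ≤ g x := fun x => by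
    rw [← hG]
    exact (conj_anti (le_trunc _ _) x).trans (conj_conj_le hg.1.2.2.1 x)
  have hψG : ∀ b x, ((inner ℝ b x - G x : ℝ) : EReal) ≤ trunc (conj g) m b := fun b x => by
    have := le_conj (trunc (conj g) m) b x
    rw [hG] at this
    rw [EReal.coe_sub]
    refine EReal.sub_le_of_le_add' ?_
    rwa [EReal.sub_le_iff_le_add (Or.inr (EReal.coe_ne_top _)) (Or.inr (EReal.coe_ne_bot _))] at this
  have hfin : expInt volume (trunc (conj g) m) < ⊤ :=
    expInt_trunc_lt_top (B := G 0) fun y => by simpa using hψG y 0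
  obtain ⟨w, hw⟩ : ∃ w : ℝ, expInt volume (trunc (conj g) m) = ENNReal.ofReal (Real.exp w) :=
    ⟨Real.log (expInt volume (trunc (conj g) m)).toReal, by
      rw [Real.exp_log (ENNReal.toReal_pos h0 hfin.ne), ENNReal.ofReal_toReal hfin.ne]⟩
  have hGbd : ∀ z, |G (gradient V z)| ≤ |G 0| + m * k := fun z =>
    (abs_le_of_lipschitz hm0 hGLip _).trans
      (by gcongr; exact norm_gradient_le hk hLip z)
  have hGi : Integrable (fun z => G (gradient V z)) (gibbs V ℓ) :=
    (integrable_const (|G 0| + m * k)).mono' (hGm.comp hgm).aestronglyMeasurable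
      (Filter.Eventually.of_forall hGbd)
  have hfi : Integrable (fun z => inner ℝ (gradient V z) z - V z) (gibbs V ℓ) :=
    integrable_gibbs hVm (by fun_prop) hδ hVle (abs_inner_gradient_sub_le hk hLip) ℓ
  have hD : ∀ᵐ z : E n, DifferentiableAt ℝ V z := hLip.ae_differentiableAt
  have main := log_le_integral_gibbs hVm hℓ
    (h := fun z => G (gradient V z) - (inner ℝ (gradient V z) z - V z))
    (by fun_prop) (hGi.sub hfi) (C := |G 0| + m * k + V 0) ?_
    (measurable_trunc (measurable_conj g) m) (fun y h => ?_) hw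
    (N := {z | DifferentiableAt ℝ V z}ᶜ) (measurableSet_of_differentiableAt ℝ V).compl
    (ae_iff.1 hD) ?_
  · rw [hw]
    refine ENNReal.ofReal_le_ofReal (Real.exp_le_exp.2 (main.trans ?_))
    rw [integral_sub hGi hfi,
      (integrable_toReal_map_gradient hf.1 hk hδ hVle hV hLip hatt).2]
    have hgi := integrable_toReal (measurable_of_mem_F hg.1) hg.2.1 hg.2.2
    have : ∫ z, G (gradient V z) ∂(gibbs V ℓ) ≤
        ∫ x, (g x).toReal ∂((gibbs V ℓ).map (gradient V)) := by
      rw [← integral_map (f := G) hgm.aemeasurable hGm.aestronglyMeasurable]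
      refine integral_mono_ae ?_ hgi ?_
      · rw [integrable_map_measure hGm.aestronglyMeasurable hgm.aemeasurable]
        exact hGi
      · filter_upwards [ae_ne_top (measurable_of_mem_F hg.1) hg.2.1] with x hx
        have := EReal.toReal_le_toReal (hGle x) (EReal.coe_ne_bot _) hx
        simpa using this
    linarith
  -- The subgradient inequality at the origin bounds `V(z) - ⟨∇V(z), z⟩` by `V(0)`.
  · refine ae_gibbs_of_ae ?_
    filter_upwards [hD] with z hz
    have h1 := (apply_gradient hV hatt hz).2 0
    rw [zero_sub, inner_neg_right] at h1
    have h2 := (abs_le.1 (hGbd z)).2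
    linarith
  · have := hψG y 0
    rw [h, le_bot_iff] at this
    exact EReal.coe_ne_bot _ this
  · intro t a b s ht0 ht1 hz hs
    simp only [Set.mem_compl_iff, Set.mem_ofPred_eq, not_not] at hz
    set z := (1 - t) • a + t • b with hzdef
    have h1 := (apply_gradient hV hatt hz).2 a
    have h2 := hψG b (gradient V z)
    rw [hs, EReal.coe_le_coe_iff, real_inner_comm] at h2
    have h3 : inner ℝ (gradient V z) z =
        (1 - t) * inner ℝ (gradient V z) a + t * inner ℝ (gradient V z) b := by
      nth_rewrite 2 [hzdef]
      rw [inner_add_right, real_inner_smul_right, real_inner_smul_right]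
    rw [inner_sub_right] at h1
    have h4 := mul_le_mul_of_nonneg_left h1 (by linarith : 0 ≤ 1 - t)
    have h5 := mul_le_mul_of_nonneg_left h2 ht0.le
    rw [h3] at h4 ⊢
    nlinarith

end Moment

/-- The image of the Gibbs measure of the conjugate of a truncation of `f` under the gradient map
almost realizes the supremum defining the twisted entropy. -/
theorem exists_moment_measure {f : E n → EReal} (hf : f ∈ F n) {k : ℝ}
    (hk : ∃ x, ‖x‖ ≤ k ∧ f x ≠ ⊤) {δ M : ℝ} (hδ : 0 < δ)
    (hle : ∀ y, ((δ * ‖y‖ - M : ℝ) : EReal) ≤ conj (trunc f k) y) :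
    ∃ ν ∈ Pc n, ∃ ℓ : ℝ, expInt volume (conj (trunc f k)) = ENNReal.ofReal (Real.exp ℓ) ∧
      f ∈ FL1 ν ∧ (∀ A : E n ≃ₗᵢ[ℝ] E n, (∀ x, f (A x) = f x) → ν.map A = ν) ∧
      K ν volume ≤ ((ℓ - ∫ x, (f x).toReal ∂ν : ℝ) : EReal) := by
  obtain ⟨V, hV, hLip, hatt⟩ := exists_conj_trunc hf.1 hf.2.2.1 hk
  obtain ⟨x₁, hx₁, -⟩ := hk
  have hk0 : 0 ≤ k := (norm_nonneg _).trans hx₁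
  have hVm : Measurable V := hLip.continuous.measurable
  have hgm := measurable_gradient V
  have hVle : ∀ y, δ * ‖y‖ - M ≤ V y := fun y => by
    have := hle y
    rw [hV] at this
    exact_mod_cast this
  obtain ⟨ℓ, hℓ⟩ := exists_lintegral_exp_neg_eq hVm hδ hVle
  have hprob := isProbabilityMeasure_gibbs hVm hℓ
  have hint := (integrable_toReal_map_gradient (ℓ := ℓ) hf.1 hk0 hδ hVle hV hLip hatt).1
  refine ⟨(gibbs V ℓ).map (gradient V),
    ⟨Measure.isProbabilityMeasure_map hgm.aemeasurable, Metric.closedBall 0 k,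
      isCompact_closedBall 0 k, ?_⟩, ℓ, ?_, ⟨hf, ?_, ?_⟩, fun A hA => ?_,
      K_map_gradient_le hf hk0 hδ hVle hℓ hV hLip hatt⟩
  · rw [Measure.map_apply hgm measurableSet_closedBall.compl]
    convert measure_empty (μ := gibbs V ℓ)
    ext z
    simpa using norm_gradient_le hk0 hLip z
  · rw [← hℓ]
    refine lintegral_congr fun y => ?_
    rw [hV, ← EReal.coe_neg, EReal.exp_coe]
  · exact posInt_lt_top_of_integrable (ae_map_apply_gradient hf.1 hV hLip hatt) hint
  · exact negInt_lt_top_of_integrable (Filter.Eventually.of_forall hf.2.2.1) hint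
  · have hVA : ∀ y, V (A y) = V y := fun y => by
      have := conj_trunc_map k hA y
      rw [hV, hV] at this
      exact_mod_cast this
    have hAm : Measurable A := A.continuous.measurable
    rw [Measure.map_map hAm hgm, show A ∘ gradient V = gradient V ∘ A from
      funext fun y => (gradient_map hVA y).symm, ← Measure.map_map hgm hAm, gibbs_map hVm ℓ hVA]

/-! ### Removing the truncation: approximate duality -/

theorem iSup_conj_trunc (f : E n → EReal) (y : E n) :
    ⨆ k : ℕ, conj (trunc f k) y = conj f y := by
  refine le_antisymm (iSup_le fun k => conj_anti (le_trunc f k) y) (iSup_le fun x => ?_)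
  obtain ⟨k, hk⟩ := exists_nat_ge ‖x‖
  refine le_trans ?_ (le_iSup _ k)
  have := le_conj (trunc f k) x y
  rwa [trunc_of_le hk] at this

theorem trunc_anti (f : E n → EReal) {k l : ℝ} (hkl : k ≤ l) (x : E n) :
    trunc f l x ≤ trunc f k x := by
  rcases le_or_gt ‖x‖ k with hx | hx
  · rw [trunc_of_le hx, trunc_of_le (hx.trans hkl)]
  · rw [trunc_of_lt hx]; exact le_top

/-- The integrands decrease as the ball grows, so one finite integral, here at radius `k₀`, is
needed to pass to the limit. -/
theorem tendsto_expInt_conj_trunc {f : E n → EReal} {k₀ : ℕ}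
    (hfin : expInt volume (conj (trunc f k₀)) ≠ ⊤) :
    Filter.Tendsto (fun k : ℕ => expInt volume (conj (trunc f (k + k₀ : ℕ)))) Filter.atTop
      (nhds (expInt volume (conj f))) := by
  refine lintegral_tendsto_of_tendsto_of_antitone
    (fun k => (measurable_conj _).neg.ereal_exp.aemeasurable) ?_ (by simpa [expInt] using hfin) ?_
  · refine Filter.Eventually.of_forall fun y i j hij => ?_
    rw [EReal.exp_le_exp_iff, EReal.neg_le_neg_iff]
    exact conj_anti (trunc_anti f (by exact_mod_cast Nat.add_le_add_right hij k₀)) y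
  · refine Filter.Eventually.of_forall fun y => ?_
    refine ((ENNReal.continuous_exp.comp continuous_neg).tendsto _).comp ?_
    have h := tendsto_atTop_iSup (f := fun k : ℕ => conj (trunc f k) y) fun i j hij =>
      conj_anti (trunc_anti f (by exact_mod_cast hij)) y
    rw [iSup_conj_trunc] at h
    exact h.comp (Filter.tendsto_add_atTop_nat k₀)

/-- Approximate duality between the twisted log-Laplace functional and the twisted entropy. -/
theorem exists_measure_K_le {f : E n → EReal} (hf : f ∈ F n) {ℓ ε : ℝ} (hε : 0 < ε)
    (hℓ : expInt volume (conj f) = ENNReal.ofReal (Real.exp ℓ)) :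
    ∃ ν ∈ Pc n, f ∈ FL1 ν ∧ (∀ A : E n ≃ₗᵢ[ℝ] E n, (∀ x, f (A x) = f x) → ν.map A = ν) ∧
      K ν volume ≤ ((ℓ + ε - ∫ x, (f x).toReal ∂ν : ℝ) : EReal) := by
  obtain ⟨δ, M, R, hδ, hR⟩ := exists_norm_le_conj_trunc hf.2.2.2
    (by rw [hℓ]; exact ENNReal.ofReal_pos.2 (Real.exp_pos _)) (by rw [hℓ]; exact ENNReal.ofReal_ne_top)
  obtain ⟨x₁, hx₁⟩ := hf.2.2.2
  obtain ⟨k₀, hk₀⟩ := exists_nat_ge (max R ‖x₁‖)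
  have hmom : ∀ k : ℕ, k₀ ≤ k → _ := fun k hk =>
    have hk' : (k₀ : ℝ) ≤ k := by exact_mod_cast hk
    exists_moment_measure hf (k := k)
      ⟨x₁, (le_max_right _ _).trans (hk₀.trans hk'), hx₁⟩ hδ
      (hR k ((le_max_left _ _).trans (hk₀.trans hk')))
  obtain ⟨-, -, ℓ₀, hℓ₀, -⟩ := hmom k₀ le_rfl
  have htend := tendsto_expInt_conj_trunc (f := f) (k₀ := k₀) (by rw [hℓ₀]; exact ENNReal.ofReal_ne_top)
  have hlt : expInt volume (conj f) < ENNReal.ofReal (Real.exp (ℓ + ε)) := by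
    rw [hℓ, ENNReal.ofReal_lt_ofReal_iff (Real.exp_pos _), Real.exp_lt_exp]
    linarith
  obtain ⟨k, hk⟩ := (htend.eventually (gt_mem_nhds hlt)).exists
  obtain ⟨ν, hν, ℓ', hℓ', hfν, hinv, hK⟩ := hmom (k + k₀) (Nat.le_add_left _ _)
  refine ⟨ν, hν, hfν, hinv, hK.trans ?_⟩
  rw [hℓ', ENNReal.ofReal_lt_ofReal_iff (Real.exp_pos _), Real.exp_lt_exp] at hk
  exact_mod_cast by linarith

/-! ### Perturbation by the norm and degenerate values of the entropy -/

theorem expInt_pos_of_le_ball {g : E n → EReal} {u : E n} {r α : ℝ} (hr : 0 < r)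
    (h : ∀ y, ‖y - u‖ ≤ r → g y ≤ α) : 0 < expInt volume g := by
  have hle : ∫⁻ y, (Metric.closedBall u r).indicator
      (fun _ => ENNReal.ofReal (Real.exp (-α))) y ≤ expInt volume g := by
    refine lintegral_mono fun y => ?_
    by_cases hy : y ∈ Metric.closedBall u r
    · rw [Set.indicator_of_mem hy, ← EReal.exp_coe, EReal.exp_le_exp_iff, EReal.coe_neg,
        EReal.neg_le_neg_iff]
      exact h y (by simpa [dist_eq_norm] using hy)
    · rw [Set.indicator_of_notMem hy]; exact zero_le
  refine lt_of_lt_of_le ?_ hle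
  rw [lintegral_indicator_const measurableSet_closedBall]
  exact ENNReal.mul_pos (ENNReal.ofReal_pos.2 (Real.exp_pos _)).ne'
    (Metric.measure_closedBall_pos volume u hr).ne'

/-- An affine minorant of `f` is integrable because `ν` has a finite first moment. -/
theorem negInt_lt_top {f : E n → EReal} (hf : f ∈ F n) {ν : Measure (E n)} (hν : ν ∈ P1 n) :
    negInt ν f < ⊤ := by
  obtain ⟨hprob, hint⟩ := hν
  obtain ⟨u, α, h⟩ := exists_affine_le hf
  have hi : Integrable (fun x => |α| + ‖u‖ * ‖x‖) ν := (integrable_const _).add (hint.const_mul _)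
  refine lt_of_le_of_lt (lintegral_mono fun x => ?_) hi.lintegral_lt_top
  rw [← EReal.toReal_coe (|α| + ‖u‖ * ‖x‖), ← EReal.toENNReal_of_ne_top (EReal.coe_ne_top _)]
  refine EReal.toENNReal_le_toENNReal ?_
  rw [EReal.neg_le, ← EReal.coe_neg]
  refine le_trans ?_ (h x)
  have h1 := (abs_le.1 (abs_real_inner_le_norm u x)).1
  have h2 := le_abs_self α
  exact_mod_cast by linarith

theorem mem_FL1_of_ae_le {q : E n → EReal} (hq : q ∈ F n) {ν : Measure (E n)} (hν : ν ∈ P1 n)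
    {A : E n → ℝ} (hA : Integrable A ν) (h : ∀ᵐ x ∂ν, q x ≤ A x) :
    q ∈ FL1 ν ∧ ∫ x, (q x).toReal ∂ν ≤ ∫ x, A x ∂ν := by
  have hp : posInt ν q < ⊤ := by
    refine lt_of_le_of_lt (lintegral_mono_ae ?_) hA.lintegral_lt_top
    filter_upwards [h] with x hx
    simpa using EReal.toENNReal_le_toENNReal hx
  have hn := negInt_lt_top hq hν
  refine ⟨⟨hq, hp, hn⟩, integral_mono_ae (integrable_toReal (measurable_of_mem_F hq) hp hn) hA ?_⟩
  filter_upwards [h] with x hx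
  simpa using EReal.toReal_le_toReal hx (hq.2.2.1 x) (EReal.coe_ne_top _)

theorem add_norm_mem_F {f : E n → EReal} (hf : f ∈ F n) :
    (fun x => f x + ((‖x‖ : ℝ) : EReal)) ∈ F n := by
  obtain ⟨hlsc, hconv, hbot, x₁, hx₁⟩ := hf
  refine ⟨?_, fun x y a b ha hb hab => ?_, fun x => ?_, x₁, ?_⟩
  · refine LowerSemicontinuous.add' hlsc (Continuous.lowerSemicontinuous
      (continuous_coe_real_ereal.comp continuous_norm)) fun x => ?_
    exact EReal.continuousAt_add (Or.inr (EReal.coe_ne_bot _)) (Or.inl (hbot x))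
  · have h1 := hconv x y a b ha hb hab
    have h2 : ‖a • x + b • y‖ ≤ a * ‖x‖ + b * ‖y‖ := by
      refine (norm_add_le _ _).trans_eq ?_
      rw [norm_smul, norm_smul, Real.norm_of_nonneg ha.le, Real.norm_of_nonneg hb.le]
    refine (add_le_add h1 (EReal.coe_le_coe_iff.2 h2)).trans (le_of_eq ?_)
    rw [EReal.coe_add, EReal.coe_mul, EReal.coe_mul,
      EReal.left_distrib_of_nonneg_of_ne_top (by exact_mod_cast ha.le) (EReal.coe_ne_top _),
      EReal.left_distrib_of_nonneg_of_ne_top (by exact_mod_cast hb.le) (EReal.coe_ne_top _)]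
    exact add_add_add_comm _ _ _ _
  · exact fun h => by simp [EReal.add_eq_bot_iff, hbot x] at h
  · exact EReal.add_ne_top hx₁ (EReal.coe_ne_top _)

theorem add_norm_mem_FL1 {f : E n → EReal} {ν : Measure (E n)} (hν : ν ∈ P1 n) (hf : f ∈ FL1 ν) :
    (fun x => f x + ((‖x‖ : ℝ) : EReal)) ∈ FL1 ν := by
  have hm := measurable_of_mem_F hf.1
  refine (mem_FL1_of_ae_le (add_norm_mem_F hf.1) hν
    ((integrable_toReal hm hf.2.1 hf.2.2).add hν.2) ?_).1
  filter_upwards [ae_ne_top hm hf.2.1] with x hx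
  rw [Pi.add_apply, EReal.coe_add, EReal.coe_toReal hx (hf.1.2.2.1 x)]

/-- The added norm absorbs a change of slope of size at most `1`, so one affine minorant of `f`
bounds the conjugate above on a whole unit ball. -/
theorem expInt_conj_add_norm_pos {f : E n → EReal} (hf : f ∈ F n) :
    0 < expInt volume (conj fun x => f x + ((‖x‖ : ℝ) : EReal)) := by
  obtain ⟨u, α, h⟩ := exists_affine_le hf
  refine expInt_pos_of_le_ball (u := u) (α := α) one_pos fun y hy => ?_
  refine conj_le_of_affine_le fun x => ?_
  refine le_trans ?_ (add_le_add (h x) le_rfl)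
  have h1 : inner ℝ (y - u) x ≤ 1 * ‖x‖ :=
    (real_inner_le_norm _ _).trans (mul_le_mul_of_nonneg_right hy (norm_nonneg x))
  rw [inner_sub_left] at h1
  exact_mod_cast by linarith

/-- A measure charging the domain of an integrable convex function with `∫ e^{-f} = 0` has infinite
twisted entropy. -/
theorem K_eq_top {f : E n → EReal} {ν : Measure (E n)} (hν : ν ∈ P1 n) (hf : f ∈ FL1 ν)
    (h0 : expInt volume f = 0) : K ν volume = ⊤ := by
  have hF := add_norm_mem_F hf.1
  have hK := le_K (add_norm_mem_FL1 hν hf) volume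
  -- Were this finite, the conjugate would grow linearly, so `f + ‖x‖`, and with it `f`, would be
  -- bounded above near the origin, contradicting `∫ e^{-f} = 0`.
  have htop : expInt volume (conj fun x => f x + ((‖x‖ : ℝ) : EReal)) = ⊤ := by
    by_contra hne
    obtain ⟨δ, M, hδ, h⟩ := exists_norm_le_conj hF.2.2.2 (expInt_conj_add_norm_pos hf.1) hne
    refine (expInt_pos_of_le_ball (g := f) (u := 0) (α := M) hδ fun x hx => ?_).ne' h0
    rw [sub_zero] at hx
    have h1 : f x ≤ f x + ((‖x‖ : ℝ) : EReal) :=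
      le_add_of_nonneg_right (by exact_mod_cast norm_nonneg x)
    refine h1.trans ?_
    rw [← congrFun (conj_conj hF) x]
    refine conj_le_of_affine_le fun y => le_trans ?_ (h y)
    have := (real_inner_le_norm x y).trans (mul_le_mul_of_nonneg_right hx (norm_nonneg y))
    exact_mod_cast by linarith
  rw [htop, ENNReal.log_top, EReal.coe_add_top, top_le_iff] at hK
  exact hK

theorem zero_mem_F : (fun _ => 0 : E n → EReal) ∈ F n :=
  ⟨lowerSemicontinuous_const, by simp, by simp, 0, by simp⟩

theorem K_ne_bot {ν : Measure (E n)} (hν : ν ∈ P1 n) : K ν volume ≠ ⊥ := by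
  have h0 : (fun _ => 0 : E n → EReal) ∈ FL1 ν := ⟨zero_mem_F, by simp [posInt], by simp [negInt]⟩
  have hK := le_K (add_norm_mem_FL1 hν h0) volume
  intro h
  rw [h, le_bot_iff, EReal.add_eq_bot_iff] at hK
  rcases hK with hK | hK
  · exact EReal.coe_ne_bot _ hK
  · exact (expInt_conj_add_norm_pos zero_mem_F).ne' (ENNReal.log_eq_bot_iff.1 hK)

theorem Pc_subset_P1 : Pc n ⊆ P1 n := by
  rintro ν ⟨hprob, C, hC, hν⟩
  refine ⟨hprob, ?_⟩
  obtain ⟨R, hR⟩ := hC.isBounded.exists_norm_le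
  refine (integrable_const R).mono' (by fun_prop) ?_
  filter_upwards [measure_eq_zero_iff_ae_notMem.1 hν] with x hx
  rw [norm_norm]
  exact hR x (by simpa using hx)

theorem eInt_eq_top {f : E n → EReal} (hf : f ∈ F n) {ν : Measure (E n)} (hν : ν ∈ P1 n)
    (h : posInt ν f = ⊤) : eInt ν f = ⊤ := by
  rw [eInt, h, EReal.coe_ennreal_top, ← EReal.coe_ennreal_toReal (negInt_lt_top hf hν).ne,
    EReal.top_sub_coe]

theorem eInt_ne_bot {f : E n → EReal} (hf : f ∈ F n) {ν : Measure (E n)} (hν : ν ∈ P1 n) :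
    eInt ν f ≠ ⊥ := by
  rcases eq_or_ne (posInt ν f) ⊤ with h | h
  · simp [eInt_eq_top hf hν h]
  · rw [eInt_eq_integral (measurable_of_mem_F hf) h.lt_top (negInt_lt_top hf hν)]
    exact EReal.coe_ne_bot _

/-! ### Averaging a convex function over a finite group of isometries -/

section Average

variable {G : Type*} [Group G] [Fintype G] (ρ : G →* (E n ≃ₗᵢ[ℝ] E n))

/-- The average of a closed convex function over the action of a finite group of isometries,
as the supremum of the averages of its affine minorants. -/
noncomputable def average (f : E n → EReal) (x : E n) : EReal :=
  ⨆ p : {p : G → E n × ℝ // ∀ g, conj f (p g).1 ≤ (p g).2},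
    (((Fintype.card G : ℝ)⁻¹ * ∑ g, (inner ℝ (ρ g x) (p.1 g).1 - (p.1 g).2) : ℝ) : EReal)

theorem le_average {f : E n → EReal} {p : G → E n × ℝ} (hp : ∀ g, conj f (p g).1 ≤ (p g).2)
    (x : E n) : (((Fintype.card G : ℝ)⁻¹ * ∑ g, (inner ℝ (ρ g x) (p g).1 - (p g).2) : ℝ) : EReal) ≤
      average ρ f x :=
  le_iSup (fun p : {p : G → E n × ℝ // ∀ g, conj f (p g).1 ≤ (p g).2} =>
    (((Fintype.card G : ℝ)⁻¹ * ∑ g, (inner ℝ (ρ g x) (p.1 g).1 - (p.1 g).2) : ℝ) : EReal)) ⟨p, hp⟩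

theorem lowerSemicontinuous_average (f : E n → EReal) : LowerSemicontinuous (average ρ f) := by
  refine lowerSemicontinuous_iSup fun p => Continuous.lowerSemicontinuous
    (continuous_coe_real_ereal.comp ?_)
  refine continuous_const.mul (continuous_finsetSum _ fun g _ => ?_)
  exact ((ρ g).continuous.inner continuous_const).sub continuous_const

theorem average_convex (f : E n → EReal) (x y : E n) (a b : ℝ) (ha : 0 < a) (hb : 0 < b)
    (hab : a + b = 1) : average ρ f (a • x + b • y) ≤
      (a : EReal) * average ρ f x + (b : EReal) * average ρ f y := by
  refine iSup_le fun p => ?_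
  refine le_trans (le_of_eq ?_) (add_le_add
    (mul_le_mul_of_nonneg_left (le_average ρ p.2 x)
      (by exact_mod_cast ha.le))
    (mul_le_mul_of_nonneg_left (le_average ρ p.2 y)
      (by exact_mod_cast hb.le)))
  norm_cast
  rw [mul_left_comm, mul_left_comm b, ← mul_add, Finset.mul_sum (a := a), Finset.mul_sum (a := b),
    ← Finset.sum_add_distrib]
  congr 1
  refine Finset.sum_congr rfl fun g _ => ?_
  rw [map_add, map_smul, map_smul, inner_add_left, real_inner_smul_left, real_inner_smul_left]
  linear_combination (p.1 g).2 * hab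

theorem average_apply (f : E n → EReal) (g : G) (x : E n) :
    average ρ f (ρ g x) = average ρ f x := by
  have key : ∀ (g : G) (x : E n), average ρ f (ρ g x) ≤ average ρ f x := fun g x => by
    refine iSup_le fun p => ?_
    refine le_trans (le_of_eq ?_) (le_average ρ (fun h => p.2 (h * g⁻¹)) x)
    congr 2
    rw [← Equiv.sum_comp (Equiv.mulRight g)
      (fun h => inner ℝ (ρ h x) (p.1 (h * g⁻¹)).1 - (p.1 (h * g⁻¹)).2)]
    simp [map_mul]
  refine le_antisymm (key g x) ?_
  have := key g⁻¹ (ρ g x)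
  rwa [show ρ g⁻¹ (ρ g x) = x by
    change (ρ g⁻¹ * ρ g) x = x
    rw [← map_mul, inv_mul_cancel, map_one]
    rfl] at this

theorem average_ne_bot {f : E n → EReal} (hf : f ∈ F n) (x : E n) : average ρ f x ≠ ⊥ := by
  obtain ⟨y, hy⟩ := (conj_mem_F hf).2.2.2
  refine ne_of_gt (lt_of_lt_of_le (EReal.bot_lt_coe _) (le_average ρ
    (p := fun _ => (y, (conj f y).toReal)) (fun _ => EReal.le_coe_toReal hy) x))

theorem average_le {f : E n → EReal} (hbot : ∀ x, f x ≠ ⊥) {x : E n}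
    (h : ∀ g, f (ρ g x) ≠ ⊤) : average ρ f x ≤
      (((Fintype.card G : ℝ)⁻¹ * ∑ g, (f (ρ g x)).toReal : ℝ) : EReal) := by
  refine iSup_le fun p => EReal.coe_le_coe_iff.2 ?_
  refine mul_le_mul_of_nonneg_left (Finset.sum_le_sum fun g _ => ?_) (by positivity)
  have h1 := (le_conj f (ρ g x) (p.1 g).1).trans (p.2 g)
  obtain ⟨t, ht⟩ : ∃ t : ℝ, f (ρ g x) = t := ⟨_, (EReal.coe_toReal (h g) (hbot _)).symm⟩
  rw [ht] at h1 ⊢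
  norm_cast at h1
  rw [EReal.toReal_coe]
  linarith

/-- The family of slopes `ρ g y` averages to the single slope `y`, because each `ρ g` preserves
inner products. Hence averaging does not raise the conjugate above the average of the conjugates. -/
theorem conj_average_le {f : E n → EReal} {y : E n}
    (h : ∀ g, conj f (ρ g y) ≠ ⊤) : conj (average ρ f) y ≤
      (((Fintype.card G : ℝ)⁻¹ * ∑ g, (conj f (ρ g y)).toReal : ℝ) : EReal) := by
  refine conj_le_of_affine_le fun x => ?_
  refine le_trans (le_of_eq ?_) (le_average ρ
    (p := fun g => (ρ g y, (conj f (ρ g y)).toReal)) (fun g => EReal.le_coe_toReal (h g)) x)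
  norm_cast
  have hc : (Fintype.card G : ℝ) ≠ 0 := by exact_mod_cast Fintype.card_ne_zero
  simp only [LinearIsometryEquiv.inner_map_map, Finset.sum_sub_distrib, Finset.sum_const,
    Finset.card_univ, nsmul_eq_mul, mul_sub, inv_mul_cancel_left₀ hc, real_inner_comm]

theorem ae_and_integral_average {q : E n → EReal} (hq : Measurable q) {ν : Measure (E n)}
    (hν : ∀ g, ν.map (ρ g) = ν) (hp : posInt ν q < ⊤) (hn : negInt ν q < ⊤) :
    (∀ᵐ x ∂ν, ∀ g, q (ρ g x) ≠ ⊤) ∧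
    Integrable (fun x => (Fintype.card G : ℝ)⁻¹ * ∑ g, (q (ρ g x)).toReal) ν ∧
    ∫ x, (Fintype.card G : ℝ)⁻¹ * ∑ g, (q (ρ g x)).toReal ∂ν = ∫ x, (q x).toReal ∂ν := by
  have hmp : ∀ g, MeasurePreserving (ρ g) ν ν := fun g => ⟨(ρ g).continuous.measurable, hν g⟩
  have hemb : ∀ g, MeasurableEmbedding (ρ g) := fun g => (ρ g).toHomeomorph.measurableEmbedding
  have hi := integrable_toReal hq hp hn
  have hig : ∀ g, Integrable (fun x => (q (ρ g x)).toReal) ν := fun g =>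
    ((hmp g).integrable_comp_emb (hemb g)).2 hi
  refine ⟨ae_all_iff.2 fun g => (hmp g).quasiMeasurePreserving.ae (ae_ne_top hq hp),
    (integrable_finsetSum _ fun g _ => hig g).const_mul _, ?_⟩
  have hc : (Fintype.card G : ℝ) ≠ 0 := by exact_mod_cast Fintype.card_ne_zero
  rw [integral_const_mul, integral_finsetSum _ fun g _ => hig g]
  simp only [(hmp _).integral_comp (hemb _) (fun x => (q x).toReal), Finset.sum_const,
    Finset.card_univ, nsmul_eq_mul, inv_mul_cancel_left₀ hc]

/-- Invariance of the measures gives the pointwise averages of `f` and `f*` the same integrals as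
`f` and `f*`; these averages dominate `average ρ f` and its conjugate almost everywhere. -/
theorem exists_invariant_le {f : E n → EReal} {ν₁ ν₂ : Measure (E n)} (hν₁ : ν₁ ∈ P1 n)
    (hν₂ : ν₂ ∈ P1 n) (hi₁ : ∀ g, ν₁.map (ρ g) = ν₁) (hi₂ : ∀ g, ν₂.map (ρ g) = ν₂)
    (hf₁ : f ∈ FL1 ν₁) (hf₂ : conj f ∈ FL1 ν₂) :
    ∃ q : E n → EReal, (∀ g x, q (ρ g x) = q x) ∧ q ∈ FL1 ν₁ ∧ conj q ∈ FL1 ν₂ ∧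
      ∫ x, (q x).toReal ∂ν₁ ≤ ∫ x, (f x).toReal ∂ν₁ ∧
      ∫ x, (conj q x).toReal ∂ν₂ ≤ ∫ x, (conj f x).toReal ∂ν₂ := by
  have hprob := hν₁.1
  obtain ⟨a1, a2, a3⟩ := ae_and_integral_average ρ (measurable_of_mem_F hf₁.1) hi₁ hf₁.2.1 hf₁.2.2
  obtain ⟨b1, b2, b3⟩ := ae_and_integral_average ρ (measurable_conj f) hi₂ hf₂.2.1 hf₂.2.2
  have hle₁ : ∀ᵐ x ∂ν₁, average ρ f x ≤
      (((Fintype.card G : ℝ)⁻¹ * ∑ g, (f (ρ g x)).toReal : ℝ) : EReal) := by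
    filter_upwards [a1] with x hx
    exact average_le ρ hf₁.1.2.2.1 hx
  have hle₂ : ∀ᵐ x ∂ν₂, conj (average ρ f) x ≤
      (((Fintype.card G : ℝ)⁻¹ * ∑ g, (conj f (ρ g x)).toReal : ℝ) : EReal) := by
    filter_upwards [b1] with x hx
    exact conj_average_le ρ hx
  have hF : average ρ f ∈ F n := by
    refine ⟨lowerSemicontinuous_average ρ f, average_convex ρ f, average_ne_bot ρ hf₁.1, ?_⟩
    obtain ⟨x, hx⟩ := hle₁.exists
    exact ⟨x, (hx.trans_lt (EReal.coe_lt_top _)).ne⟩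
  obtain ⟨h1, h2⟩ := mem_FL1_of_ae_le hF hν₁ a2 hle₁
  obtain ⟨h3, h4⟩ := mem_FL1_of_ae_le (conj_mem_F hF) hν₂ b2 hle₂
  exact ⟨average ρ f, average_apply ρ f, h1, h3, a3 ▸ h2, b3 ▸ h4⟩

end Average

theorem ofReal_pow_eq {c : ℝ} (hc : 0 < c) (n : ℕ) :
    ENNReal.ofReal c ^ n = ENNReal.ofReal (Real.exp (n * Real.log c)) := by
  rw [← ENNReal.ofReal_pow hc.le, Real.exp_nat_mul, Real.exp_log hc]

/-! ### The equivalence for functions and measures invariant under a group -/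

section Equivalence

variable {G : Type*} [Group G] {ρ : G →* (E n ≃ₗᵢ[ℝ] E n)} {A : Set (E n → EReal)}
  {Q : Set (Measure (E n))} {c : ℝ}

/-- Testing `K ν₁` with `q` and `K ν₂` with `q*` produces the logarithms of both integrals. Finite
entropies force these integrals to be positive and finite. -/
theorem coe_le_K_add_K (hc : 0 < c) (hI : SantaloOn A c) {ν₁ ν₂ : Measure (E n)}
    (hν₁ : ν₁ ∈ P1 n) (hν₂ : ν₂ ∈ P1 n) {k₁ k₂ : ℝ} (hk₁ : K ν₁ volume = k₁)
    (hk₂ : K ν₂ volume = k₂) {q : E n → EReal} (hq : q ∈ A) (hq₁ : q ∈ FL1 ν₁)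
    (hq₂ : conj q ∈ FL1 ν₂) :
    n * Real.log c ≤ k₁ + k₂ + ∫ x, (q x).toReal ∂ν₁ + ∫ x, (conj q x).toReal ∂ν₂ := by
  have hp₁ : 0 < expInt volume q := by
    refine pos_iff_ne_zero.2 fun h => ?_
    rw [K_eq_top hν₁ hq₁ h] at hk₁
    exact EReal.coe_ne_top _ hk₁.symm
  have hp₂ : 0 < expInt volume (conj q) := by
    refine pos_iff_ne_zero.2 fun h => ?_
    rw [K_eq_top hν₂ hq₂ h] at hk₂
    exact EReal.coe_ne_top _ hk₂.symm
  have hlog := ENNReal.log_monotone (hI q hq hp₁ hp₂)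
  rw [ENNReal.log_mul_add, ofReal_pow_eq hc, log_ofReal_exp] at hlog
  have hK₁ := le_K hq₁ volume
  have hK₂ := le_K hq₂ volume
  rw [hk₁] at hK₁
  rw [hk₂, conj_conj hq₁.1] at hK₂
  have hb₁ : ENNReal.log (expInt volume q) ≠ ⊥ := by simpa using hp₁.ne'
  have hb₂ : ENNReal.log (expInt volume (conj q)) ≠ ⊥ := by simpa using hp₂.ne'
  induction h₁ : ENNReal.log (expInt volume q) with
  | bot => exact absurd h₁ hb₁
  | top => rw [h₁, EReal.coe_add_top, top_le_iff] at hK₂; exact absurd hK₂ (EReal.coe_ne_top _)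
  | coe a =>
    induction h₂ : ENNReal.log (expInt volume (conj q)) with
    | bot => exact absurd h₂ hb₂
    | top => rw [h₂, EReal.coe_add_top, top_le_iff] at hK₁; exact absurd hK₁ (EReal.coe_ne_top _)
    | coe b =>
      rw [h₁] at hK₂ hlog
      rw [h₂] at hK₁ hlog
      norm_cast at hK₁ hK₂ hlog
      linarith

theorem transportEntropyOn_of_santaloOn [Fintype G] (hc : 0 < c)
    (hA : ∀ f, f ∈ A ↔ f ∈ F n ∧ ∀ g x, f (ρ g x) = f x)
    (hQ : ∀ ν, ν ∈ Q ↔ ∀ g, ν.map (ρ g) = ν) (hI : SantaloOn A c) :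
    TransportEntropyOn (P1 n ∩ Q) c := by
  rintro ν₁ ⟨hν₁, hi₁⟩ ν₂ ⟨hν₂, hi₂⟩
  rw [hQ] at hi₁ hi₂
  rcases eq_or_ne (K ν₁ volume) ⊤ with ht₁ | ht₁
  · rw [ht₁, EReal.top_add_of_ne_bot (K_ne_bot hν₂)]; exact le_top
  rcases eq_or_ne (K ν₂ volume) ⊤ with ht₂ | ht₂
  · rw [ht₂, EReal.add_top_of_ne_bot (K_ne_bot hν₁)]; exact le_top
  obtain ⟨k₁, hk₁⟩ : ∃ k : ℝ, K ν₁ volume = k := ⟨_, (EReal.coe_toReal ht₁ (K_ne_bot hν₁)).symm⟩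
  obtain ⟨k₂, hk₂⟩ : ∃ k : ℝ, K ν₂ volume = k := ⟨_, (EReal.coe_toReal ht₂ (K_ne_bot hν₂)).symm⟩
  have hT : ((n * Real.log c - (k₁ + k₂) : ℝ) : EReal) ≤ T ν₁ ν₂ := by
    refine le_iInf₂ fun f hf => ?_
    have hcf := conj_mem_F hf
    rcases eq_or_ne (posInt ν₁ f) ⊤ with hp₁ | hp₁
    · rw [eInt_eq_top hf hν₁ hp₁, EReal.top_add_of_ne_bot (eInt_ne_bot hcf hν₂)]; exact le_top
    rcases eq_or_ne (posInt ν₂ (conj f)) ⊤ with hp₂ | hp₂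
    · rw [eInt_eq_top hcf hν₂ hp₂, EReal.add_top_of_ne_bot (eInt_ne_bot hf hν₁)]; exact le_top
    have hn₁ := negInt_lt_top hf hν₁
    have hn₂ := negInt_lt_top hcf hν₂
    obtain ⟨q, hq, hq₁, hq₂, hle₁, hle₂⟩ := exists_invariant_le ρ hν₁ hν₂ hi₁ hi₂
      ⟨hf, hp₁.lt_top, hn₁⟩ ⟨hcf, hp₂.lt_top, hn₂⟩
    have := coe_le_K_add_K hc hI hν₁ hν₂ hk₁ hk₂ ((hA q).2 ⟨hq₁.1, hq⟩) hq₁ hq₂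
    rw [eInt_eq_integral (measurable_of_mem_F hf) hp₁.lt_top hn₁,
      eInt_eq_integral (measurable_conj f) hp₂.lt_top hn₂, ← EReal.coe_add, EReal.coe_le_coe_iff]
    linarith
  rw [hk₁, hk₂, ge_iff_le]
  induction h : T ν₁ ν₂ with
  | bot => rw [h, le_bot_iff] at hT; exact absurd hT (EReal.coe_ne_bot _)
  | top => simp
  | coe t =>
    rw [h] at hT
    norm_cast at hT ⊢
    linarith

theorem conj_apply_of_invariant {f : E n → EReal} {B : E n ≃ₗᵢ[ℝ] E n} (h : ∀ x, f (B x) = f x)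
    (y : E n) : conj f (B y) = conj f y := by
  unfold conj
  refine (B.toEquiv.surjective.iSup_comp _).symm.trans (iSup_congr fun x => ?_)
  simp [h]

theorem santaloOn_of_transportEntropyOn (hc : 0 < c)
    (hA : ∀ f, f ∈ A ↔ f ∈ F n ∧ ∀ g x, f (ρ g x) = f x)
    (hQ : ∀ ν, ν ∈ Q ↔ ∀ g, ν.map (ρ g) = ν) (hT : TransportEntropyOn (Pc n ∩ Q) c) :
    SantaloOn A c := by
  intro f hf hp₁ hp₂
  rw [hA] at hf
  obtain ⟨hf, hinv⟩ := hf
  rcases eq_or_ne (expInt volume f) ⊤ with ht₁ | ht₁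
  · rw [ht₁, ENNReal.top_mul hp₂.ne']; exact le_top
  rcases eq_or_ne (expInt volume (conj f)) ⊤ with ht₂ | ht₂
  · rw [ht₂, ENNReal.mul_top hp₁.ne']; exact le_top
  have hexp : ∀ X : ENNReal, 0 < X → X ≠ ⊤ → ∃ ℓ : ℝ, X = ENNReal.ofReal (Real.exp ℓ) :=
    fun X h0 h1 => ⟨Real.log X.toReal, by
      rw [Real.exp_log (ENNReal.toReal_pos h0.ne' h1), ENNReal.ofReal_toReal h1]⟩
  obtain ⟨ℓ₁, hℓ₁⟩ := hexp _ hp₁ ht₁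
  obtain ⟨ℓ₂, hℓ₂⟩ := hexp _ hp₂ ht₂
  have hcf := conj_mem_F hf
  rw [hℓ₁, hℓ₂, ofReal_pow_eq hc, ← ENNReal.ofReal_mul (Real.exp_pos _).le, ← Real.exp_add]
  -- Each of the two near-optimal measures below costs `ε / 2`; the integrals of `f` and `f*` in the
  -- entropy bounds cancel against those in the bound on `T`.
  refine ENNReal.ofReal_le_ofReal (Real.exp_le_exp.2 (le_of_forall_pos_le_add fun ε hε => ?_))
  obtain ⟨ν₁, hν₁, hf₁, hi₁, hK₁⟩ := exists_measure_K_le hf (half_pos hε) hℓ₂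
  obtain ⟨ν₂, hν₂, hf₂, hi₂, hK₂⟩ := exists_measure_K_le hcf (half_pos hε)
    (by rw [conj_conj hf]; exact hℓ₁)
  have h := hT ν₁ ⟨hν₁, (hQ _).2 fun g => hi₁ _ (hinv g)⟩ ν₂
    ⟨hν₂, (hQ _).2 fun g => hi₂ _ (conj_apply_of_invariant (hinv g))⟩
  have hTle : T ν₁ ν₂ ≤ eInt ν₁ f + eInt ν₂ (conj f) :=
    iInf₂_le (f := fun f (_ : f ∈ F n) => eInt ν₁ f + eInt ν₂ (conj f)) f hf
  rw [eInt_eq_integral (measurable_of_mem_F hf) hf₁.2.1 hf₁.2.2,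
    eInt_eq_integral (measurable_conj f) hf₂.2.1 hf₂.2.2] at hTle
  have h' := (EReal.sub_le_sub le_rfl hTle).trans (h.trans (add_le_add hK₁ hK₂))
  norm_cast at h'
  linarith

theorem santaloOn_iff [Fintype G] (hc : 0 < c) (ρ : G →* (E n ≃ₗᵢ[ℝ] E n))
    (hA : ∀ f, f ∈ A ↔ f ∈ F n ∧ ∀ g x, f (ρ g x) = f x)
    (hQ : ∀ ν, ν ∈ Q ↔ ∀ g, ν.map (ρ g) = ν) :
    (SantaloOn A c ↔ TransportEntropyOn (P1 n ∩ Q) c) ∧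
      (SantaloOn A c ↔ TransportEntropyOn (Pc n ∩ Q) c) := by
  have h1 := transportEntropyOn_of_santaloOn hc hA hQ
  have h2 : TransportEntropyOn (P1 n ∩ Q) c → TransportEntropyOn (Pc n ∩ Q) c :=
    fun h ν₁ hν₁ ν₂ hν₂ => h ν₁ ⟨Pc_subset_P1 hν₁.1, hν₁.2⟩ ν₂ ⟨Pc_subset_P1 hν₂.1, hν₂.2⟩
  have h3 := santaloOn_of_transportEntropyOn hc hA hQ
  exact ⟨⟨h1, fun h => h3 (h2 h)⟩, ⟨fun h => h2 (h1 h), h3⟩⟩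

end Equivalence

/-! ### Sign changes as a group action, and the three cases -/

/-- The sign vectors act on the Euclidean space by isometries. -/
noncomputable def signAction (n : ℕ) : (Fin n → ℤˣ) →* (E n ≃ₗᵢ[ℝ] E n) where
  toFun ε :=
    { LinearEquiv.ofInvolutive
        ({ toFun := signFlip fun i => ((ε i : ℤ) : ℝ)
           map_add' := fun x y => by ext i; simp [signFlip, mul_add]
           map_smul' := fun a x => by ext i; simp [signFlip, mul_left_comm] } : E n →ₗ[ℝ] E n)
        (fun x => by
          ext i
          rcases Int.units_eq_one_or (ε i) with h | h <;> simp [signFlip, h]) with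
      norm_map' := fun x => by
        change ‖signFlip (fun i => ((ε i : ℤ) : ℝ)) x‖ = ‖x‖
        rw [EuclideanSpace.norm_eq, EuclideanSpace.norm_eq]
        congr 1
        refine Finset.sum_congr rfl fun i _ => ?_
        rcases Int.units_eq_one_or (ε i) with h | h <;> simp [signFlip, h] }
  map_one' := by
    ext x i
    change signFlip _ x i = x i
    simp [signFlip]
  map_mul' ε ε' := by
    ext x i
    change signFlip _ x i = signFlip _ (signFlip _ x) i
    simp [signFlip, mul_assoc]

theorem signAction_apply (ε : Fin n → ℤˣ) :
    ⇑(signAction n ε) = signFlip fun i => ((ε i : ℤ) : ℝ) := rfl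

/-- The property `p` is left arbitrary so that the same translation serves invariant functions and
invariant measures. -/
theorem forall_isSign_iff {p : (E n → E n) → Prop} :
    (∀ ε : Fin n → ℝ, IsSign ε → p (signFlip ε)) ↔ ∀ ε, p (signAction n ε) := by
  constructor
  · intro h ε
    refine h _ fun i => ?_
    rcases Int.units_eq_one_or (ε i) with h | h <;> simp [h]
  · intro h ε hε
    have : ε = fun i => (((if ε i = 1 then 1 else -1 : ℤˣ) : ℤ) : ℝ) := by
      funext i
      rcases hε i with hi | hi
      · simp [hi]
      · rw [hi]; norm_num
    rw [this]
    exact h _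

theorem forall_units_iff {p : (E n → E n) → Prop} (h1 : p id) :
    p (fun x => -x) ↔ ∀ ε : ℤˣ, p (signAction n fun _ => ε) := by
  have e1 : ⇑(signAction n fun _ => 1) = id := by
    ext x i; simp [signAction_apply, signFlip]
  have e2 : ⇑(signAction n fun _ => -1) = fun x => -x := by
    ext x i; simp [signAction_apply, signFlip]
  constructor
  · intro h ε
    rcases Int.units_eq_one_or ε with rfl | rfl
    · rwa [e1]
    · rwa [e2]
  · intro h
    rw [← e2]
    exact h (-1)

end InverseSantalo

theorem theorem3p2 (n : ℕ) (hn : 1 ≤ n) (c : ℝ) (hc : 0 < c) :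
    ((InverseSantalo.IS n c ↔
        InverseSantalo.TransportEntropyOn (InverseSantalo.P1 n) c) ∧
      (InverseSantalo.IS n c ↔
        InverseSantalo.TransportEntropyOn (InverseSantalo.Pc n) c)) ∧
    ((InverseSantalo.ISu n c ↔
        InverseSantalo.TransportEntropyOn
          (InverseSantalo.P1 n ∩ InverseSantalo.UncondMeas n) c) ∧
      (InverseSantalo.ISu n c ↔
        InverseSantalo.TransportEntropyOn
          (InverseSantalo.Pc n ∩ InverseSantalo.UncondMeas n) c)) ∧
    ((InverseSantalo.ISs n c ↔
        InverseSantalo.TransportEntropyOn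
          (InverseSantalo.P1 n ∩ InverseSantalo.SymmMeas n) c) ∧
      (InverseSantalo.ISs n c ↔
        InverseSantalo.TransportEntropyOn
          (InverseSantalo.Pc n ∩ InverseSantalo.SymmMeas n) c)) := by
  refine ⟨?_, ?_, ?_⟩
  -- The trivial group imposes no invariance.
  · have := InverseSantalo.santaloOn_iff (A := InverseSantalo.F n) (Q := Set.univ) hc
      (1 : Unit →* _) (fun f => by simp) (fun ν => by
        simp only [Set.mem_univ, MonoidHom.one_apply, forall_const, true_iff]
        exact MeasureTheory.Measure.map_id)
    rwa [Set.inter_univ, Set.inter_univ] at this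
  · exact InverseSantalo.santaloOn_iff hc (InverseSantalo.signAction n)
      (fun f => and_congr_right fun _ =>
        InverseSantalo.forall_isSign_iff (p := fun B => ∀ x, f (B x) = f x))
      (fun ν => InverseSantalo.forall_isSign_iff (p := fun B => ν.map B = ν))
  -- Symmetry is invariance under the diagonal copy of `ℤˣ` in the group of sign vectors.
  · exact InverseSantalo.santaloOn_iff hc
      ((InverseSantalo.signAction n).comp (MonoidHom.pi fun _ => MonoidHom.id ℤˣ))
      (fun f => and_congr_right fun _ =>
        InverseSantalo.forall_units_iff (p := fun B => ∀ x, f (B x) = f x) fun _ => rfl)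
      (fun ν => InverseSantalo.forall_units_iff (p := fun B => ν.map B = ν)
        MeasureTheory.Measure.map_id)
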